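/- Let $s>2$, $s\neq4$. For $k\in\mathbb N$ let $L_k$ be the $k$-path Laplacian of the infinite square lattice $\mathbb Z^2$, $(L_ku)(v)=\sum_{w:\,d(v,w)=k}(u(v)-u(w))$ with $d$ the graph distance, and let $l_k$ be its Fourier symbol: for $p,q\in[-\pi,\pi]$, $$l_k(p,q)=\begin{cases}4k-i\,\dfrac{\sin p\,(e^{ikp}-e^{-ikp})-\sin q\,(e^{ikq}-e^{-ikq})}{\cos p-\cos q}, & |p|\ne|q|,\\[2ex] 4k+i\cot p\,(e^{ikp}-e^{-ikp})-k(e^{ikp}+e^{-ikp}), & |p|=|q|\ne0,\pi,\\ 0,& p=q=0,\\ 4k(1-(-1)^k),&|p|=|q|=\pi.\end{cases}$$ Let $l_s(p,q)=\sum_{k=1}^\infty k^{-s}\,l_k(p,q)$ be the Fourier symbol of the Mellin-transformed $k$-path Laplacian $\sum_{k\ge1}k^{-s}L_k$. Put $C_s=-\dfrac{2\pi}{\Gamma(s)\sin(s\pi/2)}$ if $s\notin2\mathbb Z$ and $C_s=0$ if $s\in2\mathbb Z$, let $\zeta$ be the Riemann zeta function, and put $\gamma_s=\frac{\zeta(s-1)+2\zeta(s-3)}{3}$,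 $$h_{1,s}(p,q)=\begin{cases}C_s\dfrac{|p|^s-|q|^s}{p^2-q^2},&|p|\neq|q|,\\[1.5ex]\dfrac{sC_s}{2}|p|^{s-2},&|p|=|q|,\end{cases}\qquad h_{2,s}(p,q)=\gamma_s(p^2+q^2).$$ Then, as $(p,q)\to(0,0)$, $$l_s(p,q)=h_{1,s}(p,q)+h_{2,s}(p,q)+O(|p|^\alpha+|q|^\alpha),$$ where $\alpha=\min\{s,4\}$ if $s\neq6$, and $\alpha=4-\varepsilon$ with arbitrary $\varepsilon>0$ if $s=6$. In particular, as $(p,q)\to(0,0)$: - if $s\in(2,4)$, then $l_s=h_{1,s}+O(p^2+q^2)$ and $h_{1,s}$ dominates, i.e. $l_s-h_{1,s}=o(h_{1,s})$; - if $s\in(4,\infty)\setminus\{6\}$, then $l_s=h_{2,s}+O(|p|^\beta+|q|^\beta)$ with $\beta=\min\{s-2,4\}$; if $s=6$, then $l_s=h_{2,s}+O(|p|^{4-\varepsilon}+|q|^{4-\varepsilon})$ for every $\varepsilon>0$; and for all $s>4$, $h_{2,s}$ dominates, i.e. $l_s-h_{2,s}=o(h_{2,s})$. -/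

import Mathlib

open Filter Topology Asymptotics

noncomputable section

namespace PathLaplacian

/-! ### The square lattice, its `k`-path Laplacians and their Fourier symbols -/

/-- The infinite square lattice: vertex set `ℤ × ℤ`, with `(i, j)` and `(m, n)` adjacent
when `|i - m| + |j - n| = 1`. -/
def squareLattice : SimpleGraph (ℤ × ℤ) where
  Adj v w := |v.1 - w.1| + |v.2 - w.2| = 1
  symm := ⟨fun v w h => by rw [abs_sub_comm w.1, abs_sub_comm w.2]; exact h⟩
  loopless := ⟨fun v h => by simp at h⟩

lemma squareLattice_adj (v w : ℤ × ℤ) :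
    squareLattice.Adj v w ↔ |v.1 - w.1| + |v.2 - w.2| = 1 := Iff.rfl

/-- The `k`-path Laplacian of the square lattice,
`(L_k u)(v) = ∑_{w : d(v, w) = k} (u(v) - u(w))`, where `d` is the graph distance
(the sum is finite for every `k`). -/
def pathLaplacian (k : ℕ) (u : ℤ × ℤ → ℂ) (v : ℤ × ℤ) : ℂ :=
  ∑ᶠ w ∈ {w : ℤ × ℤ | squareLattice.dist v w = k}, (u v - u w)

/-- The plane wave with frequency `(p, q)`. -/
def planeWave (p q : ℝ) (v : ℤ × ℤ) : ℂ :=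
  Complex.exp (((p * v.1 + q * v.2 : ℝ) : ℂ) * Complex.I)

open Classical in
/-- The Fourier symbol `l_k` of the `k`-path Laplacian of the square lattice, for
`p, q ∈ [-π, π]`, with `e^{ikx} - e^{-ikx}` written as `2 i sin (k x)` and
`e^{ikx} + e^{-ikx}` as `2 cos (k x)`. That this is the symbol is
`pathLaplacian_planeWave` below. -/
def pathSymbol (k : ℕ) (p q : ℝ) : ℝ :=
  if |p| ≠ |q| then
    4 * k + 2 * (Real.sin p * Real.sin (k * p) - Real.sin q * Real.sin (k * q))
      / (Real.cos p - Real.cos q)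
  else if p = 0 then 0
  else if |p| = Real.pi then 4 * k * (1 - (-1) ^ k)
  else 4 * k - 2 * Real.cot p * Real.sin (k * p) - 2 * k * Real.cos (k * p)

/-- The Fourier symbol `∑_{k ≥ 1} k^{-s} l_k(p, q)` of the Mellin-transformed `k`-path
Laplacian `∑_{k ≥ 1} k^{-s} L_k`. -/
def mellinSymbol (s p q : ℝ) : ℝ :=
  ∑' k : ℕ, (1 / ((k + 1 : ℕ) : ℝ) ^ s) * pathSymbol (k + 1) p q

open Classical in
/-- The constant `C_s`: it is `-2π / (Γ(s) sin(sπ/2))`, and `0` if `s` is an even integer. -/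
def constC (s : ℝ) : ℝ :=
  if ∃ n : ℤ, s = 2 * n then 0
  else -(2 * Real.pi) / (Real.Gamma s * Real.sin (s * Real.pi / 2))

open Classical in
/-- The function `h_{1,s}`. -/
def h1 (s p q : ℝ) : ℝ :=
  if |p| ≠ |q| then constC s * ((|p| ^ s - |q| ^ s) / (p ^ 2 - q ^ 2))
  else s * constC s / 2 * |p| ^ (s - 2)

/-- The constant `γ_s = (ζ(s-1) + 2 ζ(s-3)) / 3`, with `ζ` the (analytically continued)
Riemann zeta function, which is real on the real axis. -/
def gammaConst (s : ℝ) : ℝ :=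
  ((riemannZeta ((s - 1 : ℝ) : ℂ)).re + 2 * (riemannZeta ((s - 3 : ℝ) : ℂ)).re) / 3

/-- The function `h_{2,s}(p, q) = γ_s (p² + q²)`. -/
def h2 (s p q : ℝ) : ℝ := gammaConst s * (p ^ 2 + q ^ 2)

/-! ### Checks: the symbols are the symbols of the operators, and the series converges -/

lemma natAbs_le_walk {v w : ℤ × ℤ} (W : squareLattice.Walk v w) :
    (v.1 - w.1).natAbs + (v.2 - w.2).natAbs ≤ W.length := by
  induction W with
  | nil => simp
  | cons h p ih =>
    rw [squareLattice_adj] at h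
    rw [Int.abs_eq_natAbs, Int.abs_eq_natAbs] at h
    rw [SimpleGraph.Walk.length_cons]
    omega

lemma exists_walk (n : ℕ) : ∀ v w : ℤ × ℤ, (v.1 - w.1).natAbs + (v.2 - w.2).natAbs = n →
    ∃ W : squareLattice.Walk v w, W.length = n := by
  induction n with
  | zero =>
    intro v w h
    have : v = w := by ext <;> omega
    subst this
    exact ⟨.nil, rfl⟩
  | succ n ih =>
    intro v w h
    obtain ⟨x, hx, hxw⟩ : ∃ x : ℤ × ℤ, squareLattice.Adj v x ∧
        (x.1 - w.1).natAbs + (x.2 - w.2).natAbs = n := by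
      simp only [squareLattice_adj]
      rcases lt_trichotomy v.1 w.1 with h1 | h1 | h1
      · exact ⟨(v.1 + 1, v.2), by simp, by simp only; omega⟩
      · rcases lt_trichotomy v.2 w.2 with h2 | h2 | h2
        · exact ⟨(v.1, v.2 + 1), by simp, by simp only; omega⟩
        · omega
        · exact ⟨(v.1, v.2 - 1), by simp, by simp only; omega⟩
      · exact ⟨(v.1 - 1, v.2), by simp, by simp only; omega⟩
    obtain ⟨W, hW⟩ := ih x w hxw
    exact ⟨.cons hx W, by simp [hW]⟩

lemma squareLattice_dist (v w : ℤ × ℤ) :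
    squareLattice.dist v w = (v.1 - w.1).natAbs + (v.2 - w.2).natAbs := by
  obtain ⟨W, hW⟩ := exists_walk _ v w rfl
  refine le_antisymm (hW ▸ SimpleGraph.dist_le W) ?_
  obtain ⟨W', hW'⟩ := W.reachable.exists_walk_length_eq_dist
  exact hW' ▸ natAbs_le_walk W'

lemma pathLaplacian_eq (k : ℕ) (u : ℤ × ℤ → ℂ) (v : ℤ × ℤ) :
    pathLaplacian k u v = ∑ j ∈ Finset.range k,
      (4 * u v - (u (v.1 + (k - j), v.2 + j) + u (v.1 - (k - j), v.2 - j)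
        + u (v.1 - j, v.2 + (k - j)) + u (v.1 + j, v.2 - (k - j)))) := by
  classical
  let a : ℕ → ℤ × ℤ := fun j => (v.1 + ((k : ℤ) - j), v.2 + j)
  let b : ℕ → ℤ × ℤ := fun j => (v.1 - ((k : ℤ) - j), v.2 - j)
  let c : ℕ → ℤ × ℤ := fun j => (v.1 - j, v.2 + ((k : ℤ) - j))
  let d : ℕ → ℤ × ℤ := fun j => (v.1 + j, v.2 - ((k : ℤ) - j))
  have ha : Set.InjOn a (Finset.range k) := fun i _ j _ h => by
    simp only [a, Prod.mk.injEq] at h; omega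
  have hb : Set.InjOn b (Finset.range k) := fun i _ j _ h => by
    simp only [b, Prod.mk.injEq] at h; omega
  have hc : Set.InjOn c (Finset.range k) := fun i _ j _ h => by
    simp only [c, Prod.mk.injEq] at h; omega
  have hd : Set.InjOn d (Finset.range k) := fun i _ j _ h => by
    simp only [d, Prod.mk.injEq] at h; omega
  have hsplit : k ≠ 0 → {w : ℤ × ℤ | squareLattice.dist v w = k} =
      ↑((((Finset.range k).image a ∪ (Finset.range k).image b) ∪ (Finset.range k).image c)
        ∪ (Finset.range k).image d) := by
    intro hk
    ext ⟨x, y⟩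
    simp only [Set.mem_ofPred_eq, squareLattice_dist, Finset.coe_union, Finset.coe_image,
      Set.mem_union, Set.mem_image, Finset.mem_coe, Finset.mem_range, a, b, c, d, Prod.mk.injEq]
    constructor
    · intro h
      rcases le_or_gt y v.2 with hy | hy <;> rcases lt_trichotomy x v.1 with hx | hx | hx
      · exact Or.inl (Or.inl (Or.inr ⟨(v.2 - y).natAbs, by omega, by omega, by omega⟩))
      · exact Or.inr ⟨(v.1 - x).natAbs, by omega, by omega, by omega⟩
      · by_cases hy' : y = v.2
        · exact Or.inl (Or.inl (Or.inl ⟨0, by omega, by omega, by omega⟩))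
        · exact Or.inr ⟨(v.1 - x).natAbs, by omega, by omega, by omega⟩
      · exact Or.inl (Or.inr ⟨(v.1 - x).natAbs, by omega, by omega, by omega⟩)
      · exact Or.inl (Or.inr ⟨(v.1 - x).natAbs, by omega, by omega, by omega⟩)
      · exact Or.inl (Or.inl (Or.inl ⟨(v.2 - y).natAbs, by omega, by omega, by omega⟩))
    · rintro (((⟨j, hj, h1, h2⟩ | ⟨j, hj, h1, h2⟩) | ⟨j, hj, h1, h2⟩) | ⟨j, hj, h1, h2⟩) <;> omega
  rcases eq_or_ne k 0 with rfl | hk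
  · have : {w : ℤ × ℤ | squareLattice.dist v w = 0} = {v} := by
      ext w
      simp only [Set.mem_ofPred_eq, squareLattice_dist, Set.mem_singleton_iff, Prod.ext_iff]
      omega
    rw [pathLaplacian, this]
    simp
  rw [pathLaplacian, hsplit hk, finsum_mem_coe_finset, Finset.sum_union, Finset.sum_union,
    Finset.sum_union, Finset.sum_image ha, Finset.sum_image hb, Finset.sum_image hc,
    Finset.sum_image hd, ← Finset.sum_add_distrib, ← Finset.sum_add_distrib,
    ← Finset.sum_add_distrib]
  · refine Finset.sum_congr rfl fun j _ => ?_
    simp only [a, b, c, d]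
    ring
  all_goals
    rw [Finset.disjoint_left]
    rintro ⟨x, y⟩
    simp only [Finset.mem_union, Finset.mem_image, Finset.mem_range, a, b, c, d, Prod.mk.injEq]
  · rintro ⟨i, hi, h1, h2⟩ ⟨j, hj, h3, h4⟩; omega
  · rintro (⟨i, hi, h1, h2⟩ | ⟨i, hi, h1, h2⟩) ⟨j, hj, h3, h4⟩ <;> omega
  · rintro ((⟨i, hi, h1, h2⟩ | ⟨i, hi, h1, h2⟩) | ⟨i, hi, h1, h2⟩) ⟨j, hj, h3, h4⟩ <;> omega

lemma planeWave_add (p q : ℝ) (v w : ℤ × ℤ) :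
    planeWave p q (v.1 + w.1, v.2 + w.2) + planeWave p q (v.1 - w.1, v.2 - w.2)
      = 2 * (Real.cos (p * w.1 + q * w.2) : ℝ) * planeWave p q v := by
  simp only [planeWave, Complex.ofReal_cos, Complex.two_cos, add_mul, ← Complex.exp_add]
  congr 1 <;> · congr 1; push_cast; ring

lemma pathLaplacian_planeWave_aux (k : ℕ) (p q : ℝ) (v : ℤ × ℤ) :
    pathLaplacian k (planeWave p q) v = ((∑ j ∈ Finset.range k,
      (4 - 2 * (Real.cos ((k - j) * p + j * q) + Real.cos ((k - j) * q - j * p))) : ℝ) : ℂ)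
        * planeWave p q v := by
  rw [pathLaplacian_eq, Complex.ofReal_sum, Finset.sum_mul]
  refine Finset.sum_congr rfl fun j _ => ?_
  have h1 := planeWave_add p q v ((k : ℤ) - j, j)
  have h2 := planeWave_add p q v (-(j : ℤ), (k : ℤ) - j)
  simp only [sub_neg_eq_add, ← sub_eq_add_neg] at h1 h2
  rw [show p * (((k : ℤ) - j : ℤ) : ℝ) + q * ((j : ℤ) : ℝ) = (k - j) * p + j * q by
    push_cast; ring] at h1
  rw [show p * ((-(j : ℤ) : ℤ) : ℝ) + q * (((k : ℤ) - j : ℤ) : ℝ) = (k - j) * q - j * p by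
    push_cast; ring] at h2
  rw [Complex.ofReal_sub, Complex.ofReal_mul, Complex.ofReal_add]
  push_cast at h1 h2 ⊢
  linear_combination -h1 - h2

lemma sum_cos_one (k : ℕ) (p q : ℝ) :
    2 * (Real.cos p - Real.cos q) * ∑ j ∈ Finset.range k, Real.cos ((k - j) * p + j * q)
      = Real.cos ((k + 1) * p) - Real.cos (p + k * q) + Real.cos ((k - 1) * q)
        - Real.cos (k * p - q) := by
  have h := Finset.sum_range_sub (fun j : ℕ =>
    Real.cos ((k - j) * p + (j - 1) * q) - Real.cos ((k - j + 1) * p + j * q)) k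
  have e : ∀ j : ℕ, 2 * (Real.cos p - Real.cos q) * Real.cos ((k - j) * p + j * q)
      = (Real.cos ((k - (j + 1 : ℕ)) * p + ((j + 1 : ℕ) - 1) * q)
          - Real.cos ((k - (j + 1 : ℕ) + 1) * p + (j + 1 : ℕ) * q))
        - (Real.cos ((k - j) * p + (j - 1) * q) - Real.cos ((k - j + 1) * p + j * q)) := by
    intro j
    push_cast
    rw [show ((k : ℝ) - (j + 1)) * p + (j + 1 - 1) * q = ((k - j) * p + j * q) - p by ring,
      show ((k : ℝ) - (j + 1) + 1) * p + (j + 1) * q = ((k - j) * p + j * q) + q by ring,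
      show ((k : ℝ) - j) * p + (j - 1) * q = ((k - j) * p + j * q) - q by ring,
      show ((k : ℝ) - j + 1) * p + j * q = ((k - j) * p + j * q) + p by ring,
      Real.cos_sub, Real.cos_sub, Real.cos_add _ q, Real.cos_add _ p]
    ring
  rw [Finset.mul_sum, Finset.sum_congr rfl fun j _ => e j, h]
  push_cast
  ring_nf

lemma sum_cos_two (k : ℕ) (p : ℝ) :
    Real.sin p * ∑ j ∈ Finset.range k, Real.cos ((k - j) * p - j * p)
      = Real.cos p * Real.sin (k * p) := by
  have h := Finset.sum_range_sub (fun j : ℕ => -Real.sin ((k - 2 * j + 1) * p)) k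
  have e : ∀ j : ℕ, 2 * Real.sin p * Real.cos ((k - j) * p - j * p)
      = -Real.sin ((k - 2 * (j + 1 : ℕ) + 1) * p) - -Real.sin ((k - 2 * j + 1) * p) := by
    intro j
    push_cast
    rw [show ((k : ℝ) - 2 * (j + 1) + 1) * p = ((k - j) * p - j * p) - p by ring,
      show ((k : ℝ) - 2 * j + 1) * p = ((k - j) * p - j * p) + p by ring,
      Real.sin_sub, Real.sin_add]
    ring
  have h' : 2 * Real.sin p * ∑ j ∈ Finset.range k, Real.cos ((k - j) * p - j * p)
      = 2 * (Real.cos p * Real.sin (k * p)) := by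
    rw [Finset.mul_sum, Finset.sum_congr rfl fun j _ => e j, h]
    rw [show ((k : ℝ) - 2 * k + 1) * p = -(k * p - p) by ring,
      show ((k : ℝ) - 2 * (0 : ℕ) + 1) * p = k * p + p by push_cast; ring,
      Real.sin_neg, Real.sin_sub, Real.sin_add]
    ring
  linarith

lemma cos_ne_cos {p q : ℝ} (hp : p ∈ Set.Icc (-Real.pi) Real.pi)
    (hq : q ∈ Set.Icc (-Real.pi) Real.pi) (h : |p| ≠ |q|) : Real.cos p - Real.cos q ≠ 0 := by
  intro h0
  refine h (Real.injOn_cos ⟨abs_nonneg _, abs_le.2 hp⟩ ⟨abs_nonneg _, abs_le.2 hq⟩ ?_)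
  rw [Real.cos_abs, Real.cos_abs]
  linarith

lemma pathSymbol_eq_sum (k : ℕ) {p q : ℝ} (hp : p ∈ Set.Icc (-Real.pi) Real.pi)
    (hq : q ∈ Set.Icc (-Real.pi) Real.pi) :
    pathSymbol k p q = ∑ j ∈ Finset.range k,
      (4 - 2 * (Real.cos ((k - j) * p + j * q) + Real.cos ((k - j) * q - j * p))) := by
  rw [Finset.sum_sub_distrib, ← Finset.mul_sum, Finset.sum_add_distrib]
  simp only [Finset.sum_const, Finset.card_range, nsmul_eq_mul]
  unfold pathSymbol
  by_cases h : |p| ≠ |q|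
  · rw [if_pos h]
    have hne := cos_ne_cos hp hq h
    have h1 := sum_cos_one k p q
    have h2 := sum_cos_one k q (-p)
    simp only [mul_neg, ← sub_eq_add_neg, sub_neg_eq_add, Real.cos_neg] at h2
    rw [add_mul, one_mul, Real.cos_add, Real.cos_add, sub_mul, one_mul, Real.cos_sub,
      Real.cos_sub] at h1 h2
    generalize ∑ j ∈ Finset.range k, Real.cos ((k - j) * p + j * q) = T at h1 ⊢
    generalize ∑ j ∈ Finset.range k, Real.cos ((k - j) * q - j * p) = T' at h2 ⊢
    field_simp
    linear_combination h1 - h2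
  · rw [if_neg h]
    have hpq : q = p ∨ q = -p := by
      rcases abs_eq_abs.1 (not_ne_iff.1 h) with h | h
      · exact Or.inl h.symm
      · exact Or.inr (by linarith)
    have hsum : ∑ j ∈ Finset.range k, Real.cos ((k - j) * p + j * q)
        + ∑ j ∈ Finset.range k, Real.cos ((k - j) * q - j * p)
        = k * Real.cos (k * p) + ∑ j ∈ Finset.range k, Real.cos ((k - j) * p - j * p) := by
      rw [← Finset.sum_add_distrib]
      rw [show (k : ℝ) * Real.cos (k * p) = ∑ j ∈ Finset.range k, Real.cos (k * p) by simp,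
        ← Finset.sum_add_distrib]
      refine Finset.sum_congr rfl fun j _ => ?_
      rcases hpq with rfl | rfl
      · congr 2; ring
      · rw [add_comm, ← Real.cos_neg ((k - j) * -p - j * p)]
        congr 2 <;> ring
    rw [hsum]
    by_cases h0 : p = 0
    · rw [if_pos h0]; subst h0; simp; ring
    rw [if_neg h0]
    by_cases hpi : |p| = Real.pi
    · rw [if_pos hpi]
      have hc : ∀ n : ℤ, Real.cos (n * p) = (-1) ^ n := by
        intro n
        rcases abs_eq Real.pi_pos.le |>.1 hpi with h | h
        · rw [h, Real.cos_int_mul_pi]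
        · rw [h, mul_neg, Real.cos_neg, Real.cos_int_mul_pi]
      have hck : Real.cos (k * p) = (-1) ^ k := by simpa using hc k
      have hcj : ∀ j : ℕ, Real.cos ((k - j) * p - j * p) = (-1) ^ k := by
        intro j
        have := hc (k - 2 * j)
        rw [zpow_sub₀ (by norm_num), zpow_mul] at this
        rw [← sub_mul, sub_sub, ← two_mul]
        simpa using this
      simp only [hck, hcj, Finset.sum_const, Finset.card_range, nsmul_eq_mul]
      ring
    · rw [if_neg hpi]
      have hs : Real.sin p ≠ 0 := by
        intro hs
        have hlt : |p| < Real.pi := lt_of_le_of_ne (abs_le.2 hp) hpi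
        exact h0 ((Real.sin_eq_zero_iff_of_lt_of_lt (abs_lt.1 hlt).1 (abs_lt.1 hlt).2).1 hs)
      have := sum_cos_two k p
      generalize ∑ j ∈ Finset.range k, Real.cos ((k - j) * p - j * p) = T at this ⊢
      rw [Real.cot_eq_cos_div_sin]
      field_simp
      linear_combination 2 * this

/-- `l_k` is the Fourier symbol of `L_k`. -/
theorem pathLaplacian_planeWave (k : ℕ) {p q : ℝ} (hp : p ∈ Set.Icc (-Real.pi) Real.pi)
    (hq : q ∈ Set.Icc (-Real.pi) Real.pi) (v : ℤ × ℤ) :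
    pathLaplacian k (planeWave p q) v = (pathSymbol k p q : ℂ) * planeWave p q v := by
  rw [pathLaplacian_planeWave_aux, pathSymbol_eq_sum k hp hq]

lemma abs_pathSymbol_le (k : ℕ) {p q : ℝ} (hp : p ∈ Set.Icc (-Real.pi) Real.pi)
    (hq : q ∈ Set.Icc (-Real.pi) Real.pi) : |pathSymbol k p q| ≤ 8 * k := by
  rw [pathSymbol_eq_sum k hp hq]
  refine (Finset.abs_sum_le_sum_abs _ _).trans ((Finset.sum_le_card_nsmul _ _ 8 ?_).trans ?_)
  · intro j _
    have a1 := Real.cos_le_one ((k - j) * p + j * q)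
    have a2 := Real.neg_one_le_cos ((k - j) * p + j * q)
    have b1 := Real.cos_le_one ((k - j) * q - j * p)
    have b2 := Real.neg_one_le_cos ((k - j) * q - j * p)
    rw [abs_le]; constructor <;> linarith
  · simp [mul_comm]

/-- The series defining the Mellin symbol converges for `s > 2`. -/
theorem summable_mellinSymbol {s p q : ℝ} (hs : 2 < s)
    (hp : p ∈ Set.Icc (-Real.pi) Real.pi) (hq : q ∈ Set.Icc (-Real.pi) Real.pi) :
    Summable fun k : ℕ => (1 / ((k + 1 : ℕ) : ℝ) ^ s) * pathSymbol (k + 1) p q := by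
  have h0 : Summable fun k : ℕ => 8 * (1 / ((k + 1 : ℕ) : ℝ) ^ (s - 1)) :=
    ((summable_nat_add_iff 1).2
      (Real.summable_one_div_nat_rpow.2 (by linarith : 1 < s - 1))).mul_left 8
  refine Summable.of_norm_bounded h0 fun k => ?_
  have hk : (0 : ℝ) < ((k + 1 : ℕ) : ℝ) := by positivity
  rw [norm_mul, Real.norm_eq_abs, Real.norm_eq_abs, abs_of_nonneg (by positivity),
    Real.rpow_sub_one hk.ne']
  calc 1 / ((k + 1 : ℕ) : ℝ) ^ s * |pathSymbol (k + 1) p q|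
      ≤ 1 / ((k + 1 : ℕ) : ℝ) ^ s * (8 * ((k + 1 : ℕ) : ℝ)) := by
        gcongr; exact abs_pathSymbol_le _ hp hq
    _ = _ := by field_simp

/-- The Mellin symbol is the Fourier symbol of `∑_{k ≥ 1} k^{-s} L_k`. -/
theorem hasSum_mellin_planeWave {s p q : ℝ} (hs : 2 < s)
    (hp : p ∈ Set.Icc (-Real.pi) Real.pi) (hq : q ∈ Set.Icc (-Real.pi) Real.pi) (v : ℤ × ℤ) :
    HasSum (fun k : ℕ => ((1 / ((k + 1 : ℕ) : ℝ) ^ s : ℝ) : ℂ)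
        * pathLaplacian (k + 1) (planeWave p q) v)
      ((mellinSymbol s p q : ℂ) * planeWave p q v) := by
  have h := (Complex.hasSum_ofReal.2 (summable_mellinSymbol hs hp hq).hasSum).mul_right
    (planeWave p q v)
  simp only [pathLaplacian_planeWave _ hp hq, ← mul_assoc, ← Complex.ofReal_mul]
  exact h

end PathLaplacian

end

/-!
The symbol is a divided difference. With `T(p) = ∑ k ^ (1 - s) cos (k p)` and
`S(p) = ∑ k ^ (-s) sin (k p)`, so that `S' = T`, one has
`l_s(p, q) = 4 ζ(s-1) + 2 (G(p) - G(q)) / (cos p - cos q)` for `G(p) = sin p * S(p)`, and its limit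
`4 ζ(s-1) - 2 G'(p) / sin p` on the diagonal. Everything is even in `p` and `q`, hence only the
behaviour of `T` at `0+` matters.

The expansion `T(p) = ζ(s-1) - ζ(s-3) p² / 2 - (s-1) C_s p ^ (s-2) / 4 + O(p⁴)`
(`cosSeries_isBigO`) is elementary for `s ≥ 6`, up to `p ^ (4-ε)` at `s = 6`: expand the cosine
termwise; the singular term is then absorbed in the error or has coefficient `0`. For `2 < s < 6`
it comes from Hurwitz's formula, by which a multiple of `T(2πa)`, with a factor that does not
vanish because `s ≠ 4`, is the even Hurwitz zeta function `½ ∑_{n ∈ ℤ} |n + a| ^ w` at `w = s - 2`.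
There the term `n = 0` is the singular one, and the other terms are expanded in powers of `a`. This
makes sense for `Re w < -1`, and subtracting Taylor polynomials of degree `5` continues it to
`Re w < 5` (`hurwitzZetaEven_neg`). The functional equation of `ζ` restores the coefficients
`ζ(s-1)` and `ζ(s-3)` (`hurwitzFactor_mul_cosZeta`).

Integration gives the expansion of `S`. The main part of `G` is then written as
`2 ζ(s-1) (1 - cos p) - γ_s (1 - cos p)² - C_s p ^ s / 4`: with respect to `cos`, twice the
divided differences of the first two terms are explicit and, with `4 ζ(s-1)`, produce `h2` up to
fourth order, and that of the last one is `h1` up to a factor `1 + O(p² + q²)`. Cauchy's mean value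
theorem bounds the divided difference of the remainder by the supremum of the quotient of derivatives
(`numRemainderDeriv_isBigO`, `exists_abs_mellinSymbol_sub_le`). Dominance follows because `h1` is
comparable with `C_s max(|p|, |q|) ^ (s-2)` (`exists_h1_eq`), where `C_s > 0` for `2 < s < 4`, and
because `γ_s > 0` for `s > 4`.
-/

open Filter Topology Asymptotics

noncomputable section

namespace PathLaplacian

/-! ### Taylor expansion of `(1 + x) ^ w`, uniform in the exponent -/

lemma norm_le_mul_pow_succ_of_norm_deriv_le {f f' : ℝ → ℂ} {b C : ℝ} {m : ℕ} (hC : 0 ≤ C)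
    (hf : ∀ x ∈ Set.Icc (-b) b, HasDerivAt f (f' x) x) (h0 : f 0 = 0)
    (hb : ∀ x ∈ Set.Icc (-b) b, ‖f' x‖ ≤ C * |x| ^ m) :
    ∀ x ∈ Set.Icc (-b) b, ‖f x‖ ≤ C * |x| ^ (m + 1) := by
  intro x hx
  have hsub : Set.uIcc 0 x ⊆ Set.Icc (-b) b :=
    Set.uIcc_subset_Icc ⟨by linarith [hx.1, hx.2], by linarith [hx.1, hx.2]⟩ hx
  have key := Convex.norm_image_sub_le_of_norm_hasDerivWithin_le (s := Set.uIcc 0 x) (f := f)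
    (f' := f') (C := C * |x| ^ m) (x := 0) (y := x)
    (fun y hy => (hf y (hsub hy)).hasDerivWithinAt) (fun y hy => (hb y (hsub hy)).trans ?_)
    (convex_uIcc 0 x) Set.left_mem_uIcc Set.right_mem_uIcc
  · rw [h0, sub_zero, sub_zero, Real.norm_eq_abs] at key
    rw [pow_succ, ← mul_assoc]
    exact key
  · have : |y| ≤ |x| := by simpa using Set.abs_sub_left_of_mem_uIcc hy
    gcongr

/-- The difference of `(1 + x) ^ w` and its Taylor polynomial of degree `k - 1` at `x = 0`. -/
def binomRemainder (k : ℕ) (w x : ℂ) : ℂ :=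
  (1 + x) ^ w - ∑ j ∈ Finset.range k, (descPochhammer ℂ j).eval w / j.factorial * x ^ j

lemma hasDerivAt_binomRemainder (k : ℕ) (w : ℂ) {x : ℂ} (hx : 1 + x ∈ Complex.slitPlane) :
    HasDerivAt (binomRemainder (k + 1) w) (w * binomRemainder k (w - 1) x) x := by
  have h1 := ((hasDerivAt_id x).const_add 1).cpow_const (c := w) hx
  have h2 : HasDerivAt (fun x : ℂ => ∑ j ∈ Finset.range (k + 1),
      (descPochhammer ℂ j).eval w / j.factorial * x ^ j)
      (∑ j ∈ Finset.range (k + 1),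
        (descPochhammer ℂ j).eval w / j.factorial * (j * x ^ (j - 1))) x :=
    HasDerivAt.fun_sum fun j _ => (hasDerivAt_pow j x).const_mul _
  refine (h1.sub h2).congr_deriv ?_
  rw [Finset.sum_range_succ', binomRemainder, mul_sub, Finset.mul_sum]
  simp only [id, mul_one, Nat.cast_zero, zero_mul, mul_zero, add_zero]
  congr 1
  refine Finset.sum_congr rfl fun j _ => ?_
  have : ((j.factorial : ℕ) : ℂ) ≠ 0 := by exact_mod_cast j.factorial_ne_zero
  have : ((j : ℂ) + 1) ≠ 0 := by exact_mod_cast j.succ_ne_zero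
  rw [descPochhammer_succ_left, Nat.factorial_succ]
  simp only [Polynomial.eval_mul, Polynomial.eval_X, Polynomial.eval_comp, Polynomial.eval_sub,
    Polynomial.eval_one, Nat.add_sub_cancel]
  push_cast
  field_simp

lemma exists_norm_binomRemainder_le (k : ℕ) : ∀ M : ℝ, ∃ C, 0 ≤ C ∧ ∀ w : ℂ, ‖w‖ ≤ M →
    ∀ x ∈ Set.Icc (-(1 / 2) : ℝ) (1 / 2), ‖binomRemainder k w x‖ ≤ C * |x| ^ k := by
  induction k with
  | zero =>
    intro M
    refine ⟨2 ^ M, by positivity, fun w hw x hx => ?_⟩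
    have hpos : 0 < 1 + x := by linarith [hx.1]
    have habs := abs_le.1 ((Complex.abs_re_le_norm w).trans hw)
    have h : ‖(1 + x : ℂ) ^ w‖ = (1 + x) ^ w.re := by
      rw [← Complex.norm_cpow_eq_rpow_re_of_pos hpos]; push_cast; rfl
    simp only [binomRemainder, Finset.range_zero, Finset.sum_empty, sub_zero, pow_zero, mul_one]
    rw [h]
    rcases le_total 0 w.re with h0 | h0
    · calc (1 + x) ^ w.re ≤ 2 ^ w.re :=
            Real.rpow_le_rpow hpos.le (by linarith [hx.2]) h0
        _ ≤ 2 ^ M := Real.rpow_le_rpow_of_exponent_le (by norm_num) habs.2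
    · calc (1 + x) ^ w.re ≤ (1 / 2) ^ w.re :=
            Real.rpow_le_rpow_of_nonpos (by norm_num) (by linarith [hx.1]) h0
        _ = 2 ^ (-w.re) := by
            rw [one_div, Real.inv_rpow (by norm_num), Real.rpow_neg (by norm_num)]
        _ ≤ 2 ^ M := Real.rpow_le_rpow_of_exponent_le (by norm_num) (by linarith [habs.1])
  | succ k ih =>
    intro M
    obtain ⟨C, hC, h⟩ := ih (M + 1)
    refine ⟨|M| * C, by positivity, fun w hw => ?_⟩
    have hw1 : ‖w - 1‖ ≤ M + 1 := (norm_sub_le _ _).trans (by rw [norm_one]; linarith)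
    refine norm_le_mul_pow_succ_of_norm_deriv_le (f' := fun x : ℝ => w * binomRemainder k (w - 1) x)
      (f := fun x : ℝ => binomRemainder (k + 1) w x) (by positivity) (fun x hx => ?_) ?_
      (fun x hx => ?_)
    · refine (hasDerivAt_binomRemainder k w ?_).comp_ofReal
      exact Or.inl (by simp; linarith [hx.1])
    · simp [binomRemainder, Finset.sum_range_succ']
    · rw [norm_mul, mul_assoc]
      gcongr
      · exact hw.trans (le_abs_self M)
      · exact h _ hw1 x hx

lemma differentiable_binomRemainder (k : ℕ) {x : ℂ} (hx : 1 + x ≠ 0) :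
    Differentiable ℂ fun w => binomRemainder k w x := by
  intro w
  refine (differentiableAt_id.const_cpow (Or.inl hx)).sub (DifferentiableAt.fun_sum fun j _ => ?_)
  exact (((descPochhammer ℂ j).differentiable w).div_const _).mul_const _

/-! ### The regular part of the even Hurwitz zeta function -/

/-- The `n`-th term `(m + a) ^ w + (m - a) ^ w - m ^ w (2 + ⋯)`, `m = n + 1`, of the series
defining the regular part of the even Hurwitz zeta function; the Taylor polynomial of degree `5`
in `a / m` is subtracted. -/
def hurwitzTerm (a : ℝ) (n : ℕ) (w : ℂ) : ℂ :=
  ((n + 1 : ℝ) : ℂ) ^ w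
    * (binomRemainder 6 w ((a / (n + 1) : ℝ) : ℂ) + binomRemainder 6 w ((-(a / (n + 1)) : ℝ) : ℂ))

lemma div_mem_Icc {a : ℝ} (ha : a ∈ Set.Icc (0 : ℝ) (1 / 2)) (n : ℕ) :
    a / (n + 1) ∈ Set.Icc (0 : ℝ) (1 / 2) :=
  ⟨div_nonneg ha.1 (by positivity), (div_le_self ha.1 (by simp)).trans ha.2⟩

lemma exists_norm_hurwitzTerm_le (M : ℝ) : ∃ C, 0 ≤ C ∧ ∀ w : ℂ, ‖w‖ ≤ M →
    ∀ a ∈ Set.Icc (0 : ℝ) (1 / 2), ∀ n : ℕ,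
      ‖hurwitzTerm a n w‖ ≤ C * a ^ 6 * (n + 1 : ℝ) ^ (w.re - 6) := by
  obtain ⟨C, hC, h⟩ := exists_norm_binomRemainder_le 6 M
  refine ⟨2 * C, by positivity, fun w hw a ha n => ?_⟩
  have hn : (0 : ℝ) < n + 1 := by positivity
  have hx := div_mem_Icc ha n
  have h1 := h w hw (a / (n + 1)) ⟨by linarith [hx.1], hx.2⟩
  have h2 := h w hw (-(a / (n + 1))) ⟨by linarith [hx.2], by linarith [hx.1]⟩
  rw [abs_neg] at h2
  rw [abs_of_nonneg hx.1] at h1 h2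
  rw [hurwitzTerm, norm_mul, Complex.norm_cpow_eq_rpow_re_of_pos hn, Real.rpow_sub hn]
  calc (n + 1 : ℝ) ^ w.re * ‖binomRemainder 6 w ((a / (n + 1) : ℝ) : ℂ)
        + binomRemainder 6 w ((-(a / (n + 1)) : ℝ) : ℂ)‖
      ≤ (n + 1 : ℝ) ^ w.re * (C * (a / (n + 1)) ^ 6 + C * (a / (n + 1)) ^ 6) := by
        gcongr
        exact (norm_add_le _ _).trans (add_le_add h1 h2)
    _ = _ := by
        rw [show (6 : ℝ) = (6 : ℕ) by norm_num, Real.rpow_natCast]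
        field_simp
        ring

lemma summable_succ_rpow {r : ℝ} (hr : r < -1) : Summable fun n : ℕ => (n + 1 : ℝ) ^ r := by
  have := (summable_nat_add_iff 1).2 (Real.summable_nat_rpow.2 hr)
  simpa using this

/-- What remains of `∑_{m ≥ 1} ((m + a) ^ w + (m - a) ^ w)` after its terms of order at most `5` in
`a` are removed. The series converges for `Re w < 5`, and its sum is `O(a ^ 6)`. -/
def hurwitzRegular (a : ℝ) (w : ℂ) : ℂ := ∑' n : ℕ, hurwitzTerm a n w

lemma summable_hurwitzTerm {a : ℝ} (ha : a ∈ Set.Icc (0 : ℝ) (1 / 2)) {w : ℂ} (hw : w.re < 5) :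
    Summable fun n => hurwitzTerm a n w := by
  obtain ⟨C, -, h⟩ := exists_norm_hurwitzTerm_le ‖w‖
  exact Summable.of_norm_bounded
    ((summable_succ_rpow (by linarith : w.re - 6 < -1)).mul_left (C * a ^ 6)) (h w le_rfl a ha)

lemma exists_norm_hurwitzRegular_le {w : ℂ} (hw : w.re < 5) : ∃ C, 0 ≤ C ∧
    ∀ a ∈ Set.Icc (0 : ℝ) (1 / 2), ‖hurwitzRegular a w‖ ≤ C * a ^ 6 := by
  obtain ⟨C, hC, h⟩ := exists_norm_hurwitzTerm_le ‖w‖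
  have hs := summable_succ_rpow (by linarith : w.re - 6 < -1)
  refine ⟨C * ∑' n : ℕ, (n + 1 : ℝ) ^ (w.re - 6),
    mul_nonneg hC (tsum_nonneg fun n => by positivity), fun a ha => ?_⟩
  refine (tsum_of_norm_bounded (hs.mul_left (C * a ^ 6)).hasSum (h w le_rfl a ha)).trans ?_
  rw [tsum_mul_left]
  exact le_of_eq (by ring)

lemma differentiableAt_hurwitzRegular {a : ℝ} (ha : a ∈ Set.Icc (0 : ℝ) (1 / 2)) {w : ℂ}
    (hw : w.re < 5) : DifferentiableAt ℂ (hurwitzRegular a) w := by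
  obtain ⟨r, hr, hr5⟩ := exists_between hw
  set U : Set ℂ := {z | z.re < r} ∩ Metric.ball 0 (‖w‖ + 1)
  have hU : IsOpen U := (isOpen_lt Complex.continuous_re continuous_const).inter Metric.isOpen_ball
  have hwU : w ∈ U := ⟨hr, by simp⟩
  obtain ⟨C, hC, h⟩ := exists_norm_hurwitzTerm_le (‖w‖ + 1)
  refine (Complex.differentiableOn_tsum_of_summable_norm (U := U)
    (u := fun n : ℕ => C * a ^ 6 * (n + 1 : ℝ) ^ (r - 6))
    ((summable_succ_rpow (by linarith)).mul_left _) (fun n => ?_) hU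
    fun n z hz => ?_).differentiableAt (hU.mem_nhds hwU)
  · have hx := div_mem_Icc ha n
    refine Differentiable.differentiableOn fun z => ?_
    refine (differentiableAt_id.const_cpow (Or.inl ?_)).mul
      ((differentiable_binomRemainder 6 ?_ z).add (differentiable_binomRemainder 6 ?_ z))
    · exact_mod_cast n.succ_ne_zero
    · exact_mod_cast (by linarith [hx.1] : 1 + a / (n + 1) ≠ 0)
    · exact_mod_cast (by linarith [hx.2] : 1 + -(a / (n + 1)) ≠ 0)
  · refine (h z (mem_ball_zero_iff.1 hz.2).le a ha n).trans ?_
    have ha0 := ha.1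
    gcongr
    · simp
    · exact hz.1.le

open HurwitzZeta

lemma hurwitzTerm_eq {a : ℝ} (ha : a ∈ Set.Icc (0 : ℝ) (1 / 2)) (n : ℕ) (w : ℂ) :
    hurwitzTerm a n w = (n + 1 + a : ℂ) ^ w + (n + 1 - a : ℂ) ^ w - 2 * (n + 1 : ℂ) ^ w
      - w * (w - 1) * a ^ 2 * (n + 1 : ℂ) ^ (w - 2)
      - w * (w - 1) * (w - 2) * (w - 3) / 12 * a ^ 4 * (n + 1 : ℂ) ^ (w - 4) := by
  have hn : (0 : ℝ) ≤ n + 1 := by positivity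
  have hn' : (n + 1 : ℂ) ≠ 0 := by exact_mod_cast n.succ_ne_zero
  have hx := div_mem_Icc ha n
  have h1 := Complex.mul_cpow_ofReal_nonneg hn (by linarith [hx.1] : 0 ≤ 1 + a / (n + 1)) w
  have h2 := Complex.mul_cpow_ofReal_nonneg hn (by linarith [hx.2] : 0 ≤ 1 + -(a / (n + 1))) w
  rw [← Complex.ofReal_mul] at h1 h2
  rw [show (n + 1 : ℝ) * (1 + a / (n + 1)) = n + 1 + a by field_simp] at h1
  rw [show (n + 1 : ℝ) * (1 + -(a / (n + 1))) = n + 1 - a by field_simp; ring] at h2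
  rw [show w - 2 = w - (2 : ℕ) by norm_num, show w - 4 = w - (4 : ℕ) by norm_num,
    Complex.cpow_sub _ _ hn', Complex.cpow_sub _ _ hn', Complex.cpow_natCast, Complex.cpow_natCast]
  push_cast at h1 h2
  simp only [hurwitzTerm, binomRemainder, Finset.sum_range_succ, Finset.sum_range_zero,
    descPochhammer_succ_right, descPochhammer_zero, Polynomial.eval_mul, Polynomial.eval_sub,
    Polynomial.eval_X, Polynomial.eval_one, Nat.factorial]
  push_cast
  simp only [Polynomial.eval_ofNat, Polynomial.eval_zero,
    Polynomial.eval_one]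
  rw [h1, h2]
  field_simp
  ring

lemma hasSum_cpow_succ {w : ℂ} (hw : w.re < -1) :
    HasSum (fun n : ℕ => (n + 1 : ℂ) ^ w) (riemannZeta (-w)) := by
  have h : 1 < (-w).re := by rw [Complex.neg_re]; linarith
  have hs := (summable_nat_add_iff 1).2 (Complex.summable_one_div_nat_cpow.2 h)
  have e : ∀ n : ℕ, 1 / ((n + 1 : ℕ) : ℂ) ^ (-w) = (n + 1 : ℂ) ^ w := fun n => by
    rw [Complex.cpow_neg, one_div, inv_inv]
    push_cast
    rfl
  have hsum := hs.hasSum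
  simp only [e] at hsum
  have hz : riemannZeta (-w) = ∑' n : ℕ, (n + 1 : ℂ) ^ w :=
    (zeta_eq_tsum_one_div_nat_add_one_cpow h).trans
      (tsum_congr fun n => by rw [← e n]; push_cast; rfl)
  rw [hz]
  exact hsum

/-- Expansion of the even Hurwitz zeta function at `a = 0`, in the half plane of absolute
convergence. -/
lemma hurwitzZetaEven_neg_of_re_lt {a : ℝ} (ha0 : 0 < a) (ha : a ≤ 1 / 2) {w : ℂ}
    (hw : w.re < -1) :
    hurwitzZetaEven a (-w) = (a : ℂ) ^ w / 2 + riemannZeta (-w)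
      + w * (w - 1) / 2 * a ^ 2 * riemannZeta (2 - w)
      + w * (w - 1) * (w - 2) * (w - 3) / 24 * a ^ 4 * riemannZeta (4 - w)
      + hurwitzRegular a w / 2 := by
  have haI : a ∈ Set.Icc (0 : ℝ) (1 / 2) := ⟨ha0.le, ha⟩
  have h := hasSum_nat_hurwitzZetaEven_of_mem_Icc (a := a) ⟨ha0.le, by linarith⟩
    (s := -w) (by rw [Complex.neg_re]; linarith)
  have hshift : Summable fun n : ℕ => (n + 1 + a : ℂ) ^ w := by
    refine Summable.of_norm_bounded (summable_succ_rpow hw) fun n => ?_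
    have e : (n + 1 + a : ℂ) = ((n + 1 + a : ℝ) : ℂ) := by push_cast; rfl
    rw [e, Complex.norm_cpow_eq_rpow_re_of_pos (by positivity)]
    exact Real.rpow_le_rpow_of_nonpos (by positivity) (by linarith) (by linarith)
  have hfull : Summable fun n : ℕ => (n + a : ℂ) ^ w := by
    refine (summable_nat_add_iff 1).1 (hshift.congr fun n => ?_)
    push_cast; rfl
  have hR := (summable_hurwitzTerm haI (by linarith : w.re < 5)).hasSum
  have h0 := hasSum_cpow_succ hw
  have h2 := hasSum_cpow_succ (w := w - 2) (by simp; linarith)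
  have h4 := hasSum_cpow_succ (w := w - 4) (by simp; linarith)
  rw [neg_sub] at h2 h4
  have hsum := hfull.hasSum
  rw [hfull.tsum_eq_zero_add] at hsum
  simp only [Nat.cast_zero, zero_add, Nat.cast_add, Nat.cast_one] at hsum
  have htot := (((((hR.add (h0.mul_left 2)).add (h2.mul_left (w * (w - 1) * a ^ 2))).add
    (h4.mul_left (w * (w - 1) * (w - 2) * (w - 3) / 12 * a ^ 4))).sub hshift.hasSum).add
    hsum).div_const 2
  refine (h.unique (htot.congr_fun fun n => ?_)).trans ?_
  · rw [hurwitzTerm_eq haI, Complex.cpow_neg, Complex.cpow_neg, one_div, one_div, inv_inv, inv_inv]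
    ring
  · rw [hurwitzRegular]
    ring

/-- The expansion of the even Hurwitz zeta function, continued to `Re w < 5`. The upper half plane
avoids the poles of the zeta values. -/
lemma hurwitzZetaEven_neg {a : ℝ} (ha0 : 0 < a) (ha : a ≤ 1 / 2) {w : ℂ}
    (hw : w.re < 5) (hi : 0 < w.im) :
    hurwitzZetaEven a (-w) = (a : ℂ) ^ w / 2 + riemannZeta (-w)
      + w * (w - 1) / 2 * a ^ 2 * riemannZeta (2 - w)
      + w * (w - 1) * (w - 2) * (w - 3) / 24 * a ^ 4 * riemannZeta (4 - w)
      + hurwitzRegular a w / 2 := by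
  set U : Set ℂ := {z | z.re < 5} ∩ {z | 0 < z.im}
  have hU : IsOpen U := (isOpen_lt Complex.continuous_re continuous_const).inter
    (isOpen_lt continuous_const Complex.continuous_im)
  have hconv : Convex ℝ U := (convex_halfSpace_re_lt 5).inter (convex_halfSpace_im_gt 0)
  have hne : ∀ z ∈ U, ∀ r : ℝ, z ≠ r := by
    rintro z hz r rfl
    simpa using hz.2
  have hL : DifferentiableOn ℂ (fun w => hurwitzZetaEven a (-w)) U := fun z hz =>
    ((differentiableAt_hurwitzZetaEven a (fun h => hne z hz (-1) (by
      simp only [Pi.neg_apply, id] at h; push_cast; linear_combination -h))).comp z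
      differentiableAt_id.neg).differentiableWithinAt
  have hz : ∀ r : ℝ, DifferentiableOn ℂ (fun w => riemannZeta (r - w)) U := fun r z hz =>
    ((differentiableAt_riemannZeta (fun h => hne z hz (r - 1) (by
      push_cast; simp only [id] at h; linear_combination -h))).comp z
      (differentiableAt_id.const_sub (r : ℂ))).differentiableWithinAt
  have hz0 := hz 0
  have hz2 := hz 2
  have hz4 := hz 4
  simp only [Complex.ofReal_zero, zero_sub, Complex.ofReal_ofNat] at hz0 hz2 hz4
  have hreg : DifferentiableOn ℂ (hurwitzRegular a) U := fun z hz =>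
    (differentiableAt_hurwitzRegular ⟨ha0.le, ha⟩ hz.1).differentiableWithinAt
  have hpow : DifferentiableOn ℂ (fun w => (a : ℂ) ^ w) U := fun z _ =>
    (differentiableAt_id.const_cpow (Or.inl (by exact_mod_cast ha0.ne'))).differentiableWithinAt
  have hRd : DifferentiableOn ℂ (fun w => (a : ℂ) ^ w / 2 + riemannZeta (-w)
      + w * (w - 1) / 2 * a ^ 2 * riemannZeta (2 - w)
      + w * (w - 1) * (w - 2) * (w - 3) / 24 * a ^ 4 * riemannZeta (4 - w)
      + hurwitzRegular a w / 2) U := by fun_prop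
  refine (hL.analyticOnNhd hU).eqOn_of_preconnected_of_eventuallyEq (hRd.analyticOnNhd hU)
    hconv.isPreconnected (z₀ := -2 + Complex.I) ⟨by norm_num, by norm_num⟩ ?_ ⟨hw, hi⟩
  filter_upwards [(isOpen_lt Complex.continuous_re continuous_const).mem_nhds
    (show (-2 + Complex.I).re < -1 by norm_num)] with z hz
  exact hurwitzZetaEven_neg_of_re_lt ha0 ha hz

/-- The factor of Hurwitz's formula: `ζ(-w) = hurwitzFactor w * ζ(w + 1)`. -/
def hurwitzFactor (w : ℂ) : ℂ :=
  2 * (2 * Real.pi : ℂ) ^ (-(w + 1)) * Complex.Gamma (w + 1) * Complex.cos (Real.pi * (w + 1) / 2)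

lemma hurwitzFactor_sub_two {w : ℂ} (h0 : w ≠ 0) (h1 : w ≠ 1) :
    w * (w - 1) * hurwitzFactor (w - 2) = -(2 * Real.pi) ^ 2 * hurwitzFactor w := by
  have h2pi : (2 * Real.pi : ℂ) ≠ 0 := by
    exact_mod_cast (mul_pos two_pos Real.pi_pos).ne'
  have hG : Complex.Gamma (w + 1) = w * ((w - 1) * Complex.Gamma (w - 1)) := by
    rw [Complex.Gamma_add_one _ h0, ← Complex.Gamma_add_one _ (sub_ne_zero.2 h1), sub_add_cancel]
  have hc : Complex.cos (Real.pi * (w - 1) / 2) = -Complex.cos (Real.pi * (w + 1) / 2) := by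
    rw [← Complex.cos_sub_pi]; congr 1; ring
  have hp : (2 * Real.pi : ℂ) ^ (-(w - 1)) = (2 * Real.pi : ℂ) ^ (-(w + 1)) * (2 * Real.pi) ^ 2 := by
    rw [← Complex.cpow_natCast, ← Complex.cpow_add _ _ h2pi]; congr 1; push_cast; ring
  rw [hurwitzFactor, hurwitzFactor, show w - 2 + 1 = w - 1 by ring, hG, hc, hp]
  ring

lemma riemannZeta_neg_of_im_pos {w : ℂ} (hi : 0 < w.im) :
    riemannZeta (-w) = hurwitzFactor w * riemannZeta (w + 1) := by
  have hne : ∀ r : ℝ, w + 1 ≠ r := by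
    intro r h
    have := congrArg Complex.im h
    simp at this
    exact hi.ne' this
  rw [hurwitzFactor, ← riemannZeta_one_sub (fun n => by simpa using hne (-n)) (by simpa using hne 1)]
  congr 1; ring

lemma unitAddCircle_coe_ne_zero {a : ℝ} (ha0 : 0 < a) (ha : a ≤ 1 / 2) : (a : UnitAddCircle) ≠ 0 := by
  rw [Ne, AddCircle.coe_eq_zero_iff_of_mem_Ico ⟨ha0.le, by linarith⟩]
  exact ha0.ne'

/-- Expansion of the periodic zeta function `∑ cos(2πan) n ^ (-w-1)` at `a = 0`. -/
lemma hurwitzFactor_mul_cosZeta_of_im_pos {a : ℝ} (ha0 : 0 < a) (ha : a ≤ 1 / 2) {w : ℂ}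
    (hw : w.re < 5) (hi : 0 < w.im) :
    hurwitzFactor w * (cosZeta a (w + 1) - riemannZeta (w + 1)
        + (2 * Real.pi * a) ^ 2 / 2 * riemannZeta (w - 1)
        - (2 * Real.pi * a) ^ 4 / 24 * riemannZeta (w - 3))
      = (a : ℂ) ^ w / 2 + hurwitzRegular a w / 2 := by
  have hne : ∀ r : ℝ, w ≠ r := by
    rintro r rfl
    simp at hi
  have hH : hurwitzZetaEven a (-w) = hurwitzFactor w * cosZeta a (w + 1) := by
    rw [hurwitzFactor, ← hurwitzZetaEven_one_sub _ (fun n h => ?_)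
      (Or.inl (unitAddCircle_coe_ne_zero ha0 ha))]
    · congr 1; ring
    · refine hne (-n - 1) ?_
      push_cast
      rw [← h]; ring
  have h := hurwitzZetaEven_neg ha0 ha hw hi
  have e2 := riemannZeta_neg_of_im_pos (w := w - 2) (by simp [hi])
  have e4 := riemannZeta_neg_of_im_pos (w := w - 4) (by simp [hi])
  have k2 := hurwitzFactor_sub_two (w := w) (by simpa using hne 0) (by simpa using hne 1)
  have k4 := hurwitzFactor_sub_two (w := w - 2) (fun h => hne 2 (by simpa using sub_eq_zero.1 h))
    (fun h => hne 3 (by push_cast; linear_combination h))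
  rw [neg_sub] at e2 e4
  rw [show w - 2 - 2 = w - 4 by ring] at k4
  rw [show w - 2 + 1 = w - 1 by ring] at e2
  rw [show w - 4 + 1 = w - 3 by ring] at e4
  rw [hH, riemannZeta_neg_of_im_pos hi, e2, e4] at h
  linear_combination h + a ^ 2 / 2 * riemannZeta (w - 1) * k2
    + a ^ 4 / 24 * riemannZeta (w - 3) * (w * (w - 1) * k4 - (2 * Real.pi) ^ 2 * k2)

lemma hurwitzFactor_mul_cosZeta {a : ℝ} (ha0 : 0 < a) (ha : a ≤ 1 / 2) {r : ℝ} (hr0 : 0 < r)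
    (hr : r < 4) (hr2 : r ≠ 2) :
    hurwitzFactor r * (cosZeta a (r + 1) - riemannZeta (r + 1)
        + (2 * Real.pi * a) ^ 2 / 2 * riemannZeta (r - 1)
        - (2 * Real.pi * a) ^ 4 / 24 * riemannZeta (r - 3))
      = (a : ℂ) ^ (r : ℂ) / 2 + hurwitzRegular a r / 2 := by
  have hz : ∀ c : ℝ, r + c ≠ 1 → ContinuousAt (fun w : ℂ => riemannZeta (w + c)) r := fun c hc =>
    ((differentiableAt_riemannZeta (by simp only [id]; exact_mod_cast hc)).comp (r : ℂ)
      (differentiableAt_id.add_const (c : ℂ))).continuousAt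
  have z1 := hz 1 (by linarith)
  have z2 := hz (-1) (fun h => hr2 (by linarith))
  have z3 := hz (-3) (by linarith)
  simp only [Complex.ofReal_neg, Complex.ofReal_one, Complex.ofReal_ofNat, ← sub_eq_add_neg]
    at z1 z2 z3
  have hcz : ContinuousAt (fun w : ℂ => cosZeta a (w + 1)) r :=
    ((differentiableAt_cosZeta _ (Or.inr (unitAddCircle_coe_ne_zero ha0 ha))).comp (r : ℂ)
      (differentiableAt_id.add_const 1)).continuousAt
  have h2pi : (2 * Real.pi : ℂ) ≠ 0 := by
    exact_mod_cast (mul_pos two_pos Real.pi_pos).ne'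
  have hK : ContinuousAt hurwitzFactor r := by
    have hG : ContinuousAt (fun w : ℂ => Complex.Gamma (w + 1)) r :=
      ((Complex.differentiableAt_Gamma _ (fun m h => by
        have : r + 1 = -m := by simp only [id] at h; exact_mod_cast h
        have : (0 : ℝ) ≤ m := m.cast_nonneg
        linarith)).comp (r : ℂ) (differentiableAt_id.add_const 1)).continuousAt
    have hp : ContinuousAt (fun w : ℂ => (2 * Real.pi : ℂ) ^ (-(w + 1))) r :=
      ((differentiableAt_id.add_const 1).neg.const_cpow (Or.inl h2pi)).continuousAt
    unfold hurwitzFactor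
    fun_prop
  have hpow : ContinuousAt (fun w : ℂ => (a : ℂ) ^ w) r :=
    (differentiableAt_id.const_cpow (Or.inl (by exact_mod_cast ha0.ne'))).continuousAt
  have hreg := (differentiableAt_hurwitzRegular (a := a) ⟨ha0.le, ha⟩ (w := r)
    (by rw [Complex.ofReal_re]; linarith)).continuousAt
  have hL : ContinuousAt (fun w => hurwitzFactor w * (cosZeta a (w + 1) - riemannZeta (w + 1)
        + (2 * Real.pi * a) ^ 2 / 2 * riemannZeta (w - 1)
        - (2 * Real.pi * a) ^ 4 / 24 * riemannZeta (w - 3))) (r : ℂ) := by fun_prop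
  have hR : ContinuousAt (fun w : ℂ => (a : ℂ) ^ w / 2 + hurwitzRegular a w / 2) (r : ℂ) := by
    fun_prop
  -- approach `r` vertically, from the upper half plane
  have hpath : Tendsto (fun t : ℝ => (r : ℂ) + t * Complex.I) (𝓝[>] 0) (𝓝 (r : ℂ)) := by
    have : Continuous fun t : ℝ => (r : ℂ) + t * Complex.I := by fun_prop
    simpa using (this.tendsto 0).mono_left nhdsWithin_le_nhds
  refine tendsto_nhds_unique ((hL.tendsto.comp hpath).congr' ?_) (hR.tendsto.comp hpath)
  filter_upwards [self_mem_nhdsWithin] with t ht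
  exact hurwitzFactor_mul_cosZeta_of_im_pos ha0 ha (by simp; linarith) (by simpa using ht)

/-! ### The cosine and sine series -/

/-- `∑_{k ≥ 1} k ^ (-r) cos (k p)`. -/
def cosSeries (r p : ℝ) : ℝ := ∑' k : ℕ, 1 / ((k + 1 : ℕ) : ℝ) ^ r * Real.cos ((k + 1 : ℕ) * p)

/-- `∑_{k ≥ 1} k ^ (-r) sin (k p)`. -/
def sinSeries (r p : ℝ) : ℝ := ∑' k : ℕ, 1 / ((k + 1 : ℕ) : ℝ) ^ r * Real.sin ((k + 1 : ℕ) * p)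

lemma summable_one_div_succ_rpow {r : ℝ} (hr : 1 < r) :
    Summable fun k : ℕ => 1 / ((k + 1 : ℕ) : ℝ) ^ r :=
  (summable_nat_add_iff 1).2 (Real.summable_one_div_nat_rpow.2 hr)

lemma summable_cosSeries {r : ℝ} (hr : 1 < r) (p : ℝ) :
    Summable fun k : ℕ => 1 / ((k + 1 : ℕ) : ℝ) ^ r * Real.cos ((k + 1 : ℕ) * p) := by
  refine Summable.of_norm_bounded (summable_one_div_succ_rpow hr) fun k => ?_
  rw [norm_mul, Real.norm_of_nonneg (by positivity)]
  exact mul_le_of_le_one_right (by positivity) (Real.abs_cos_le_one _)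

lemma summable_sinSeries {r : ℝ} (hr : 1 < r) (p : ℝ) :
    Summable fun k : ℕ => 1 / ((k + 1 : ℕ) : ℝ) ^ r * Real.sin ((k + 1 : ℕ) * p) := by
  refine Summable.of_norm_bounded (summable_one_div_succ_rpow hr) fun k => ?_
  rw [norm_mul, Real.norm_of_nonneg (by positivity)]
  exact mul_le_of_le_one_right (by positivity) (Real.abs_sin_le_one _)

lemma one_div_succ_rpow_sub_one (r : ℝ) (k : ℕ) :
    1 / ((k + 1 : ℕ) : ℝ) ^ (r - 1) = 1 / ((k + 1 : ℕ) : ℝ) ^ r * (k + 1 : ℕ) := by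
  have : (0 : ℝ) < (k + 1 : ℕ) := by positivity
  rw [Real.rpow_sub_one this.ne']
  field_simp

lemma hasDerivAt_sinSeries {r : ℝ} (hr : 2 < r) (p : ℝ) :
    HasDerivAt (sinSeries r) (cosSeries (r - 1) p) p := by
  have hd : ∀ (k : ℕ) (y : ℝ), HasDerivAt
      (fun y : ℝ => 1 / ((k + 1 : ℕ) : ℝ) ^ r * Real.sin ((k + 1 : ℕ) * y))
      (1 / ((k + 1 : ℕ) : ℝ) ^ (r - 1) * Real.cos ((k + 1 : ℕ) * y)) y := fun k y => by
    have h := ((hasDerivAt_id' y).const_mul ((k + 1 : ℕ) : ℝ)).sin.const_mul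
      (1 / ((k + 1 : ℕ) : ℝ) ^ r)
    refine h.congr_deriv ?_
    rw [one_div_succ_rpow_sub_one]
    ring
  refine hasDerivAt_tsum (summable_one_div_succ_rpow (by linarith : 1 < r - 1)) hd
    (fun k y => ?_) (summable_sinSeries (by linarith) 0) p
  rw [norm_mul, Real.norm_of_nonneg (by positivity)]
  exact mul_le_of_le_one_right (by positivity) (Real.abs_cos_le_one _)

lemma sinSeries_zero (r : ℝ) : sinSeries r 0 = 0 := by simp [sinSeries]

open HurwitzZeta in
lemma cosZeta_eq_cosSeries {r : ℝ} (hr : 1 < r) (a : ℝ) :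
    cosZeta a (r : ℂ) = (cosSeries r (2 * Real.pi * a) : ℂ) := by
  have h := hasSum_nat_cosZeta a (s := (r : ℂ)) (by simpa using hr)
  rw [← hasSum_nat_add_iff' 1] at h
  have hr0 : (r : ℂ) ≠ 0 := by exact_mod_cast (by linarith : r ≠ 0)
  simp only [Finset.sum_range_one, Nat.cast_zero, Complex.zero_cpow hr0, div_zero, sub_zero] at h
  refine h.unique ?_
  refine (Complex.hasSum_ofReal.2 (summable_cosSeries hr (2 * Real.pi * a)).hasSum).congr_fun
    fun k => ?_
  rw [Complex.ofReal_mul, Complex.ofReal_div, Complex.ofReal_cpow (by positivity),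
    mul_comm (((k + 1 : ℕ) : ℝ)) (2 * Real.pi * a)]
  push_cast
  ring

lemma riemannZeta_re_eq_cosSeries {r : ℝ} (hr : 1 < r) :
    (riemannZeta (r : ℂ)).re = cosSeries r 0 := by
  have := cosZeta_eq_cosSeries hr 0
  rw [QuotientAddGroup.mk_zero, HurwitzZeta.cosZeta_zero, mul_zero] at this
  rw [this, Complex.ofReal_re]

lemma riemannZeta_re_eq_tsum {r : ℝ} (hr : 1 < r) :
    (riemannZeta (r : ℂ)).re = ∑' k : ℕ, 1 / ((k + 1 : ℕ) : ℝ) ^ r := by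
  rw [riemannZeta_re_eq_cosSeries hr, cosSeries]
  simp

lemma riemannZeta_re_pos {r : ℝ} (hr : 1 < r) : 0 < (riemannZeta (r : ℂ)).re := by
  rw [riemannZeta_re_eq_tsum hr]
  exact (summable_one_div_succ_rpow hr).tsum_pos (fun k => by positivity) 0 (by positivity)

/-! ### The constant `C_s` -/

lemma sin_ne_zero_of_not_even {s : ℝ} (h : ¬∃ n : ℤ, s = 2 * n) : Real.sin (s * Real.pi / 2) ≠ 0 := by
  intro h0
  obtain ⟨n, hn⟩ := Real.sin_eq_zero_iff.1 h0
  refine h ⟨n, ?_⟩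
  have := Real.pi_pos
  field_simp at hn
  linarith

lemma not_even_of_lt {s : ℝ} (hs : 2 < s) (hs4 : s ≠ 4) (hs6 : s < 6) : ¬∃ n : ℤ, s = 2 * n := by
  rintro ⟨n, rfl⟩
  have h1 : (1 : ℝ) < n := by linarith
  have h2 : (n : ℝ) < 3 := by linarith
  have h1 : 1 < n := by exact_mod_cast h1
  have h2 : n < 3 := by exact_mod_cast h2
  obtain rfl : n = 2 := by omega
  norm_num at hs4

lemma constC_six : constC 6 = 0 := if_pos ⟨3, by norm_num⟩

lemma constC_pos {s : ℝ} (hs : 2 < s) (hs4 : s < 4) : 0 < constC s := by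
  rw [constC, if_neg (not_even_of_lt hs hs4.ne (by linarith))]
  refine div_pos_of_neg_of_neg (by linarith [Real.pi_pos])
    (mul_neg_of_pos_of_neg (Real.Gamma_pos_of_pos (by linarith)) ?_)
  have h := Real.sin_pos_of_pos_of_lt_pi (x := s * Real.pi / 2 - Real.pi)
    (by nlinarith [Real.pi_pos]) (by nlinarith [Real.pi_pos])
  rw [Real.sin_sub_pi] at h
  linarith

/-! ### Expansion of the cosine series at `0` -/

lemma rpow_isBigO_rpow {a b : ℝ} (h : b ≤ a) :
    (fun p : ℝ => p ^ a) =O[𝓝[>] 0] fun p => p ^ b := by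
  refine IsBigO.of_bound 1 ?_
  filter_upwards [Ioo_mem_nhdsGT one_pos] with p hp
  have hp0 := hp.1
  rw [one_mul, Real.norm_of_nonneg (by positivity), Real.norm_of_nonneg (by positivity)]
  exact Real.rpow_le_rpow_of_exponent_ge hp.1 hp.2.le h

lemma ofReal_hurwitzFactor (s : ℝ) : hurwitzFactor ((s - 2 : ℝ) : ℂ)
    = ((2 * (2 * Real.pi) ^ (-(s - 1)) * Real.Gamma (s - 1) * Real.sin (s * Real.pi / 2) : ℝ) : ℂ) := by
  have h1 : ((s - 2 : ℝ) : ℂ) + 1 = ((s - 1 : ℝ) : ℂ) := by push_cast; ring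
  have h2 : Real.sin (s * Real.pi / 2) = Real.cos (Real.pi * (s - 1) / 2) := by
    rw [← Real.cos_sub_pi_div_two]; congr 1; ring
  rw [hurwitzFactor, h1, Complex.Gamma_ofReal, h2]
  push_cast
  rw [Complex.ofReal_cpow (by positivity)]
  push_cast
  rfl

lemma cosSeries_isBigO_of_lt_six {s : ℝ} (hs : 2 < s) (hs4 : s ≠ 4) (hs6 : s < 6) :
    (fun p : ℝ => cosSeries (s - 1) p - ((riemannZeta ((s - 1 : ℝ) : ℂ)).re
      - (riemannZeta ((s - 3 : ℝ) : ℂ)).re / 2 * p ^ 2 - (s - 1) * constC s / 4 * p ^ (s - 2)))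
      =O[𝓝[>] 0] fun p => p ^ (4 : ℝ) := by
  obtain ⟨C, hC, hreg⟩ := exists_norm_hurwitzRegular_le (w := ((s - 2 : ℝ) : ℂ))
    (by rw [Complex.ofReal_re]; linarith)
  have hsin := sin_ne_zero_of_not_even (not_even_of_lt hs hs4 hs6)
  have hG : 0 < Real.Gamma (s - 1) := Real.Gamma_pos_of_pos (by linarith)
  have hGs : Real.Gamma s = (s - 1) * Real.Gamma (s - 1) := by
    rw [← Real.Gamma_add_one (by linarith), sub_add_cancel]
  set K : ℝ := 2 * (2 * Real.pi) ^ (-(s - 1)) * Real.Gamma (s - 1) * Real.sin (s * Real.pi / 2)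
    with hK
  have hpi := Real.pi_pos
  have hK0 : K ≠ 0 := by
    have : (2 * Real.pi) ^ (-(s - 1)) ≠ 0 := by positivity
    positivity
  set ζ5 := (riemannZeta ((s - 2 : ℝ) - 3 : ℂ)).re
  refine IsBigO.of_bound (|ζ5| / 24 + C / (2 * |K|)) ?_
  filter_upwards [Ioo_mem_nhdsGT one_pos] with p hp
  have hp0 := hp.1
  set a : ℝ := p / (2 * Real.pi) with ha
  have ha0 : 0 < a := by positivity
  have hap : 2 * Real.pi * a = p := by rw [ha]; field_simp
  have h2pi : 2 ≤ 2 * Real.pi := by linarith [Real.pi_gt_three]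
  have ha2 : a ≤ 1 / 2 := by
    rw [ha, div_le_div_iff₀ (by positivity) two_pos]; linarith [hp.2]
  have hale : a ≤ p := div_le_self hp0.le (by linarith)
  have hR := hreg a ⟨ha0.le, ha2⟩
  have key := congrArg Complex.re (hurwitzFactor_mul_cosZeta ha0 ha2 (r := s - 2) (by linarith)
    (by linarith) (fun h => hs4 (by linarith)))
  have e1 : ((s - 2 : ℝ) : ℂ) + 1 = ((s - 1 : ℝ) : ℂ) := by push_cast; ring
  have e3 : ((s - 2 : ℝ) : ℂ) - 1 = ((s - 3 : ℝ) : ℂ) := by push_cast; ring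
  rw [ofReal_hurwitzFactor, ← hK, e1, e3, cosZeta_eq_cosSeries (by linarith), hap,
    show (2 * Real.pi * a : ℂ) = (p : ℂ) by rw [← hap]; push_cast; rfl,
    ← Complex.ofReal_cpow ha0.le, Complex.re_ofReal_mul,
    show ((p : ℂ) ^ 2 / 2) = ((p ^ 2 / 2 : ℝ) : ℂ) by push_cast; rfl,
    show ((p : ℂ) ^ 4 / 24) = ((p ^ 4 / 24 : ℝ) : ℂ) by push_cast; rfl] at key
  simp only [Complex.sub_re, Complex.add_re, Complex.re_ofReal_mul, Complex.ofReal_re,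
    Complex.div_ofNat_re] at key
  have hsing : K * ((s - 1) * constC s / 4 * p ^ (s - 2)) = -(a ^ (s - 2) / 2) := by
    rw [constC, if_neg (not_even_of_lt hs hs4 hs6), hGs, hK, ha,
      Real.div_rpow hp0.le (by positivity), show -(s - 1) = -(s - 2) - 1 by ring,
      Real.rpow_sub_one (by positivity), Real.rpow_neg (by positivity)]
    have : s - 1 ≠ 0 := by linarith
    have : (2 * Real.pi) ^ (s - 2) ≠ 0 := by positivity
    generalize Real.sin (s * Real.pi / 2) = S at hsin
    field_simp
    ring
  have hmain : cosSeries (s - 1) p - ((riemannZeta ((s - 1 : ℝ) : ℂ)).re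
      - (riemannZeta ((s - 3 : ℝ) : ℂ)).re / 2 * p ^ 2 - (s - 1) * constC s / 4 * p ^ (s - 2))
      = p ^ 4 * (ζ5 / 24) + (hurwitzRegular a ((s - 2 : ℝ) : ℂ)).re / (2 * K) := by
    refine mul_left_cancel₀ hK0 ?_
    rw [mul_add, show K * ((hurwitzRegular a ((s - 2 : ℝ) : ℂ)).re / (2 * K))
      = (hurwitzRegular a ((s - 2 : ℝ) : ℂ)).re / 2 by field_simp]
    linear_combination key + hsing
  rw [hmain, show (4 : ℝ) = (4 : ℕ) by norm_num, Real.rpow_natCast, Real.norm_eq_abs,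
    Real.norm_of_nonneg (by positivity)]
  have hR' : |(hurwitzRegular a ((s - 2 : ℝ) : ℂ)).re| ≤ C * p ^ 4 := by
    refine (Complex.abs_re_le_norm _).trans (hR.trans ?_)
    gcongr
    calc a ^ 6 ≤ p ^ 6 := by gcongr
      _ ≤ p ^ 4 := pow_le_pow_of_le_one hp0.le hp.2.le (by norm_num)
  refine (abs_add_le _ _).trans ?_
  rw [abs_mul, abs_div, abs_div, abs_mul, abs_of_nonneg (by positivity : 0 ≤ p ^ 4), abs_two,
    abs_of_pos (by norm_num : (0 : ℝ) < 24), add_mul]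
  have : 0 < |K| := abs_pos.2 hK0
  refine add_le_add (le_of_eq (by ring)) ?_
  rw [div_mul_eq_mul_div]
  gcongr

lemma abs_cos_sub_le {x β : ℝ} (hx : 0 < x) (h2 : 2 ≤ β) (h4 : β ≤ 4) :
    |Real.cos x - 1 + x ^ 2 / 2| ≤ 3 * x ^ β := by
  rcases le_total x 1 with h1 | h1
  · have h := Real.cos_bound (x := x) (by rwa [abs_of_pos hx])
    rw [abs_of_pos hx, show Real.cos x - (1 - x ^ 2 / 2) = Real.cos x - 1 + x ^ 2 / 2 by ring] at h
    have h' : x ^ 4 ≤ x ^ β := by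
      rw [← Real.rpow_natCast]
      exact Real.rpow_le_rpow_of_exponent_ge hx h1 (by exact_mod_cast h4)
    have : 0 ≤ x ^ 4 := by positivity
    linarith
  · have h' : x ^ 2 ≤ x ^ β := by
      rw [← Real.rpow_natCast]
      exact Real.rpow_le_rpow_of_exponent_le h1 (by exact_mod_cast h2)
    have := Real.cos_le_one x
    have := Real.neg_one_le_cos x
    have : 1 ≤ x ^ 2 := one_le_pow₀ h1
    rw [abs_le]
    constructor <;> linarith

lemma cosSeries_isBigO_of_lt_sub {s β : ℝ} (h2 : 2 ≤ β) (h4 : β ≤ 4) (hβ : β < s - 2) :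
    (fun p : ℝ => cosSeries (s - 1) p - ((riemannZeta ((s - 1 : ℝ) : ℂ)).re
      - (riemannZeta ((s - 3 : ℝ) : ℂ)).re / 2 * p ^ 2)) =O[𝓝[>] 0] fun p => p ^ β := by
  refine IsBigO.of_bound (3 * ∑' k : ℕ, 1 / ((k + 1 : ℕ) : ℝ) ^ (s - 1 - β)) ?_
  filter_upwards [self_mem_nhdsWithin] with p hp
  have hp0 : 0 < p := hp
  have hsum : HasSum (fun k : ℕ => 1 / ((k + 1 : ℕ) : ℝ) ^ (s - 1) *
      (Real.cos ((k + 1 : ℕ) * p) - 1 + ((k + 1 : ℕ) * p) ^ 2 / 2))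
      (cosSeries (s - 1) p - ((riemannZeta ((s - 1 : ℝ) : ℂ)).re
        - (riemannZeta ((s - 3 : ℝ) : ℂ)).re / 2 * p ^ 2)) := by
    rw [riemannZeta_re_eq_tsum (by linarith), riemannZeta_re_eq_tsum (by linarith)]
    have h := ((summable_cosSeries (by linarith : 1 < s - 1) p).hasSum.sub
      (summable_one_div_succ_rpow (by linarith : 1 < s - 1)).hasSum).add
      (((summable_one_div_succ_rpow (by linarith : 1 < s - 3)).hasSum.div_const 2).mul_right (p ^ 2))
    refine Eq.subst (motive := HasSum _) ?_ (h.congr_fun fun k => ?_)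
    · simp only [cosSeries]; ring
    · have hk : (0 : ℝ) < (k + 1 : ℕ) := by positivity
      rw [show s - 3 = s - 1 - (2 : ℕ) by push_cast; ring, Real.rpow_sub_natCast hk.ne']
      field_simp
  rw [← hsum.tsum_eq, Real.norm_of_nonneg (by positivity : 0 ≤ p ^ β), mul_assoc, ← tsum_mul_right,
    ← tsum_mul_left]
  refine tsum_of_norm_bounded (Summable.hasSum ?_) fun k => ?_
  · exact ((summable_one_div_succ_rpow (by linarith : 1 < s - 1 - β)).mul_right _).mul_left _
  · have hk : (0 : ℝ) < (k + 1 : ℕ) := by positivity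
    rw [norm_mul, Real.norm_of_nonneg (by positivity), Real.norm_eq_abs]
    calc _ ≤ 1 / ((k + 1 : ℕ) : ℝ) ^ (s - 1) * (3 * ((k + 1 : ℕ) * p) ^ β) := by
          gcongr
          exact abs_cos_sub_le (by positivity) h2 h4
      _ = _ := by
          rw [Real.mul_rpow hk.le hp0.le, Real.rpow_sub hk (s - 1)]
          generalize ((k + 1 : ℕ) : ℝ) ^ (s - 1) = x
          field_simp

/-- Expansion of `∑ k ^ (1 - s) cos (k p)` as `p → 0+`. At `s = 6` the term of
order `p ^ 4` carries a logarithm, so that only exponents below `4` are reached. -/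
lemma cosSeries_isBigO {s α : ℝ} (hs : 2 < s) (hs4 : s ≠ 4) (hα : α ≤ 4) (hα6 : s = 6 → α < 4) :
    (fun p : ℝ => cosSeries (s - 1) p - ((riemannZeta ((s - 1 : ℝ) : ℂ)).re
      - (riemannZeta ((s - 3 : ℝ) : ℂ)).re / 2 * p ^ 2 - (s - 1) * constC s / 4 * p ^ (s - 2)))
      =O[𝓝[>] 0] fun p => p ^ α := by
  rcases lt_trichotomy s 6 with h6 | rfl | h6
  · exact (cosSeries_isBigO_of_lt_six hs hs4 h6).trans (rpow_isBigO_rpow hα)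
  · have := (cosSeries_isBigO_of_lt_sub (s := 6) (β := max α 2) (le_max_right _ _)
      (max_le hα (by norm_num)) (max_lt (by linarith [hα6 rfl]) (by norm_num))).trans
      (rpow_isBigO_rpow (le_max_left α 2))
    simpa [constC_six] using this
  · have h1 := (cosSeries_isBigO_of_lt_sub (s := s) (β := 4) (by norm_num) le_rfl
      (by linarith)).trans (rpow_isBigO_rpow hα)
    have h2 : (fun p : ℝ => (s - 1) * constC s / 4 * p ^ (s - 2)) =O[𝓝[>] 0] fun p => p ^ α :=
      (rpow_isBigO_rpow (by linarith)).const_mul_left _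
    refine (h1.add h2).congr_left fun p => by ring

/-! ### Expansion of the sine series at `0` -/

lemma isBigO_rpow_add_one_of_hasDerivAt {f f' : ℝ → ℝ} {α : ℝ} (hα : 0 ≤ α) (hc : Continuous f)
    (h0 : f 0 = 0) (hd : ∀ p, 0 < p → HasDerivAt f (f' p) p)
    (h : f' =O[𝓝[>] 0] fun p => p ^ α) : f =O[𝓝[>] 0] fun p => p ^ (α + 1) := by
  obtain ⟨C, hC, hb⟩ := h.exists_nonneg
  obtain ⟨δ, hδ, hb⟩ := mem_nhdsGT_iff_exists_Ioo_subset.1 hb.bound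
  refine IsBigO.of_bound C ?_
  filter_upwards [Ioo_mem_nhdsGT (Set.mem_Ioi.1 hδ)] with p hp
  obtain ⟨c, hcp, hslope⟩ := exists_hasDerivAt_eq_slope f f' hp.1 hc.continuousOn
    fun x hx => hd x hx.1
  have hp0 := hp.1
  have hc0 := hcp.1
  rw [h0, sub_zero, sub_zero, eq_div_iff hp0.ne'] at hslope
  have := hb ⟨hcp.1, hcp.2.trans hp.2⟩
  simp only [Set.mem_ofPred_eq] at this
  rw [Real.norm_of_nonneg (by positivity : 0 ≤ c ^ α)] at this
  rw [Real.norm_of_nonneg (by positivity : 0 ≤ p ^ (α + 1)), Real.rpow_add_one hp0.ne', ← mul_assoc]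
  calc ‖f p‖ = ‖f' c‖ * p := by rw [← hslope, norm_mul, Real.norm_of_nonneg hp0.le]
    _ ≤ C * c ^ α * p := by gcongr
    _ ≤ C * p ^ α * p := by gcongr; exact hcp.2.le

lemma continuous_sinSeries {s : ℝ} (hs : 2 < s) : Continuous (sinSeries s) :=
  continuous_iff_continuousAt.2 fun p => (hasDerivAt_sinSeries hs p).continuousAt

lemma sinSeries_isBigO {s α : ℝ} (hs : 2 < s) (hs4 : s ≠ 4) (hα0 : 0 ≤ α) (hα : α ≤ 4)
    (hα6 : s = 6 → α < 4) :
    (fun p : ℝ => sinSeries s p - ((riemannZeta ((s - 1 : ℝ) : ℂ)).re * p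
      - (riemannZeta ((s - 3 : ℝ) : ℂ)).re / 6 * p ^ 3 - constC s / 4 * p ^ (s - 1)))
      =O[𝓝[>] 0] fun p => p ^ (α + 1) := by
  refine isBigO_rpow_add_one_of_hasDerivAt hα0 ?_ ?_ (fun p hp => ?_)
    (cosSeries_isBigO hs hs4 hα hα6)
  · have h1 := continuous_sinSeries hs
    have h2 : Continuous fun p : ℝ => p ^ (s - 1) := Real.continuous_rpow_const (by linarith)
    fun_prop
  · rw [sinSeries_zero, Real.zero_rpow (by linarith)]
    ring
  · have h3 := (Real.hasDerivAt_rpow_const (p := s - 1) (Or.inl hp.ne')).const_mul (constC s / 4)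
    have h := (hasDerivAt_sinSeries hs p).sub
      ((((hasDerivAt_id' p).const_mul (riemannZeta ((s - 1 : ℝ) : ℂ)).re).sub
      ((hasDerivAt_pow 3 p).const_mul ((riemannZeta ((s - 3 : ℝ) : ℂ)).re / 6))).sub h3)
    refine h.congr_deriv ?_
    rw [show s - 1 - 1 = s - 2 by ring]
    push_cast
    ring

/-! ### The numerator of the symbol -/

/-- The difference of `sin p * sinSeries s p` and its singular and low order parts. The latter are
written in powers of `1 - cos p`, so that their divided differences with respect to `cos` are
explicit. -/
def numRemainder (s p : ℝ) : ℝ :=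
  Real.sin p * sinSeries s p - (2 * (riemannZeta ((s - 1 : ℝ) : ℂ)).re * (1 - Real.cos p)
    - gammaConst s * (1 - Real.cos p) ^ 2 - constC s / 4 * p ^ s)

/-- The derivative of `numRemainder s`. -/
def numRemainderDeriv (s p : ℝ) : ℝ :=
  Real.cos p * sinSeries s p + Real.sin p * cosSeries (s - 1) p
    - (2 * (riemannZeta ((s - 1 : ℝ) : ℂ)).re * Real.sin p
    - 2 * gammaConst s * (1 - Real.cos p) * Real.sin p - s * constC s / 4 * p ^ (s - 1))

lemma hasDerivAt_numRemainder {s : ℝ} (hs : 2 < s) (p : ℝ) :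
    HasDerivAt (numRemainder s) (numRemainderDeriv s p) p := by
  have hc := (Real.hasDerivAt_cos p).const_sub 1
  have h := ((Real.hasDerivAt_sin p).mul (hasDerivAt_sinSeries hs p)).sub
    (((hc.const_mul (2 * (riemannZeta ((s - 1 : ℝ) : ℂ)).re)).sub
      ((hc.pow 2).const_mul (gammaConst s))).sub
      ((Real.hasDerivAt_rpow_const (p := s) (Or.inr (by linarith : 1 ≤ s))).const_mul
        (constC s / 4)))
  refine h.congr_deriv ?_
  rw [numRemainderDeriv]
  push_cast
  ring

lemma pow_isBigO_rpow {n : ℕ} {b : ℝ} (h : b ≤ n) :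
    (fun p : ℝ => p ^ n) =O[𝓝[>] 0] fun p => p ^ b := by
  simpa only [Real.rpow_natCast] using rpow_isBigO_rpow h

lemma cos_sub_isBigO : (fun p : ℝ => Real.cos p - (1 - p ^ 2 / 2)) =O[𝓝[>] 0] fun p => p ^ 4 := by
  refine IsBigO.of_bound (5 / 96) ?_
  filter_upwards [Ioo_mem_nhdsGT one_pos] with p hp
  have h := Real.cos_bound (x := p) (by rw [abs_of_pos hp.1]; exact hp.2.le)
  rw [norm_pow, Real.norm_eq_abs, Real.norm_eq_abs, mul_comm]
  exact h

lemma sin_sub_isBigO : (fun p : ℝ => Real.sin p - (p - p ^ 3 / 6)) =O[𝓝[>] 0] fun p => p ^ 5 := by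
  refine IsBigO.of_bound (1 / 100) ?_
  filter_upwards [Ioo_mem_nhdsGT one_pos] with p hp
  have h := Real.sin_bound (x := p) (by rw [abs_of_pos hp.1]; exact hp.2.le)
  rw [norm_pow, Real.norm_eq_abs, Real.norm_eq_abs, one_div_mul_eq_div]
  exact h

lemma numRemainderDeriv_isBigO {s α : ℝ} (hs : 2 < s) (hs4 : s ≠ 4) (hα0 : 0 ≤ α) (hα : α ≤ 4)
    (hα6 : s = 6 → α < 4) (hαs : α ≤ s) :
    numRemainderDeriv s =O[𝓝[>] 0] fun p => p ^ (α + 1) := by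
  have hS := sinSeries_isBigO hs hs4 hα0 hα hα6
  have hT := cosSeries_isBigO hs hs4 hα hα6
  have hγ : gammaConst s = ((riemannZeta ((s - 1 : ℝ) : ℂ)).re
    + 2 * (riemannZeta ((s - 3 : ℝ) : ℂ)).re) / 3 := rfl
  set a := (riemannZeta ((s - 1 : ℝ) : ℂ)).re
  set b := (riemannZeta ((s - 3 : ℝ) : ℂ)).re
  set c := constC s
  set g := gammaConst s
  have hcos : Real.cos =O[𝓝[>] 0] fun _ => (1 : ℝ) :=
    (Real.continuous_cos.tendsto 0).mono_left nhdsWithin_le_nhds |>.isBigO_one ℝ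
  have hsin : Real.sin =O[𝓝[>] 0] fun p : ℝ => p := by
    refine IsBigO.of_bound 1 (Eventually.of_forall fun p => ?_)
    rw [one_mul]
    exact Real.abs_sin_le_abs
  have hid : ∀ n : ℕ, 1 ≤ n → (fun p : ℝ => p ^ n) =O[𝓝[>] 0] fun p : ℝ => p := fun n hn => by
    have := pow_isBigO_rpow (n := n) (b := 1) (by exact_mod_cast hn)
    simpa using this
  have hone : ∀ f : ℝ → ℝ, Continuous f → f =O[𝓝[>] 0] fun _ => (1 : ℝ) := fun f hf =>
    (hf.tendsto 0).mono_left nhdsWithin_le_nhds |>.isBigO_one ℝ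
  have hpow : ∀ r : ℝ, 0 ≤ r → Continuous fun p : ℝ => p ^ r := fun r hr =>
    Real.continuous_rpow_const hr
  have h5 := pow_isBigO_rpow (n := 5) (b := α + 1) (by push_cast; linarith)
  have hS0 : (fun p : ℝ => a * p - b / 6 * p ^ 3 - c / 4 * p ^ (s - 1)) =O[𝓝[>] 0]
      fun p : ℝ => p := by
    refine (((isBigO_refl _ _).const_mul_left _).sub ((hid 3 (by norm_num)).const_mul_left _)).sub
      (IsBigO.const_mul_left ?_ _)
    have := rpow_isBigO_rpow (a := s - 1) (b := 1) (by linarith)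
    simpa using this
  have hT0 : (fun p : ℝ => a - b / 2 * p ^ 2 - (s - 1) * c / 4 * p ^ (s - 2) - 2 * a + g * p ^ 2)
      =O[𝓝[>] 0] fun _ => (1 : ℝ) := by
    refine hone _ ?_
    have := hpow (s - 2) (by linarith)
    fun_prop
  have e1 := (hcos.mul hS).congr_right (g₂ := fun p => p ^ (α + 1)) fun p => one_mul _
  have e2 : (fun p : ℝ => Real.sin p * (cosSeries (s - 1) p
      - (a - b / 2 * p ^ 2 - (s - 1) * c / 4 * p ^ (s - 2)))) =O[𝓝[>] 0] fun p => p ^ (α + 1) := by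
    refine (hsin.mul hT).congr' EventuallyEq.rfl ?_
    filter_upwards [self_mem_nhdsWithin] with p hp
    rw [Real.rpow_add_one (ne_of_gt hp), mul_comm]
  have e3 := (((cos_sub_isBigO.mul hS0).congr_right (g₂ := fun p : ℝ => p ^ 5)
    fun p => by ring)).trans h5
  have e4 := (((sin_sub_isBigO.mul hT0).congr_right (g₂ := fun p : ℝ => p ^ 5)
    fun p => by ring)).trans h5
  have e5 := ((((cos_sub_isBigO.mul hsin).congr_right (g₂ := fun p : ℝ => p ^ 5)
    fun p => by ring)).trans h5).const_mul_left (2 * g)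
  have e6 := h5.const_mul_left (b / 6 - g / 6)
  have e7 : (fun p : ℝ => c * (1 / 8 + (s - 1) / 24) * p ^ (s + 1)) =O[𝓝[>] 0]
      fun p => p ^ (α + 1) := (rpow_isBigO_rpow (by linarith)).const_mul_left _
  refine ((((((e1.add e2).add e3).add e4).sub e5).add e6).add e7).congr' ?_ EventuallyEq.rfl
  filter_upwards [self_mem_nhdsWithin] with p hp
  have hp0 : p ≠ 0 := ne_of_gt hp
  have p1 : p ^ (s - 1) = p ^ (s - 2) * p := by
    rw [← Real.rpow_add_one hp0]; congr 1; ring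
  have p2 : p ^ (s + 1) = p ^ (s - 2) * p ^ 3 := by
    rw [← Real.rpow_add_natCast hp0]; congr 1; push_cast; ring
  rw [numRemainderDeriv, p1, p2]
  change _ = Real.cos p * sinSeries s p + Real.sin p * cosSeries (s - 1) p
    - (2 * a * Real.sin p - 2 * g * (1 - Real.cos p) * Real.sin p
      - s * c / 4 * (p ^ (s - 2) * p))
  rw [hγ]
  ring

/-! ### Closed forms of the Mellin symbol -/

lemma tsum_zeta_term {s : ℝ} (hs : 2 < s) :
    HasSum (fun k : ℕ => 1 / ((k + 1 : ℕ) : ℝ) ^ s * (4 * (k + 1 : ℕ)))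
      (4 * (riemannZeta ((s - 1 : ℝ) : ℂ)).re) := by
  rw [riemannZeta_re_eq_tsum (by linarith)]
  refine ((summable_one_div_succ_rpow (by linarith : 1 < s - 1)).hasSum.mul_left 4).congr_fun
    fun k => ?_
  rw [one_div_succ_rpow_sub_one]
  ring

lemma mellinSymbol_of_abs_ne {s p q : ℝ} (hs : 2 < s) (h : |p| ≠ |q|) :
    mellinSymbol s p q = 4 * (riemannZeta ((s - 1 : ℝ) : ℂ)).re
      + 2 * (Real.sin p * sinSeries s p - Real.sin q * sinSeries s q)
        / (Real.cos p - Real.cos q) := by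
  have hp := (summable_sinSeries (by linarith : 1 < s) p).hasSum.mul_left (Real.sin p)
  have hq := (summable_sinSeries (by linarith : 1 < s) q).hasSum.mul_left (Real.sin q)
  refine (((tsum_zeta_term hs).add (((hp.sub hq).mul_left 2).div_const
    (Real.cos p - Real.cos q))).congr_fun fun k => ?_).tsum_eq
  rw [pathSymbol, if_pos h]
  ring

lemma mellinSymbol_of_abs_eq {s p q : ℝ} (hs : 2 < s) (h : |p| = |q|) (h0 : p ≠ 0)
    (hpi : |p| ≠ Real.pi) :
    mellinSymbol s p q = 4 * (riemannZeta ((s - 1 : ℝ) : ℂ)).re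
      - 2 * Real.cot p * sinSeries s p - 2 * cosSeries (s - 1) p := by
  have hS := (summable_sinSeries (by linarith : 1 < s) p).hasSum.mul_left (2 * Real.cot p)
  have hT := (summable_cosSeries (by linarith : 1 < s - 1) p).hasSum.mul_left 2
  refine ((((tsum_zeta_term hs).sub hS).sub hT).congr_fun fun k => ?_).tsum_eq
  rw [pathSymbol, if_neg (not_not.2 h), if_neg h0, if_neg hpi, one_div_succ_rpow_sub_one]
  ring

lemma mellinSymbol_zero (s : ℝ) : mellinSymbol s 0 0 = 0 := by
  simp [mellinSymbol, pathSymbol]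

lemma sin_abs_mul_sin (k : ℕ) (p : ℝ) :
    Real.sin |p| * Real.sin (k * |p|) = Real.sin p * Real.sin (k * p) := by
  rcases abs_choice p with h | h <;> simp [h]

lemma pathSymbol_abs (k : ℕ) (p q : ℝ) : pathSymbol k |p| |q| = pathSymbol k p q := by
  unfold pathSymbol
  simp only [abs_abs, abs_eq_zero, sin_abs_mul_sin, Real.cos_abs]
  have h : 2 * Real.cot |p| * Real.sin (k * |p|) = 2 * Real.cot p * Real.sin (k * p)
      ∧ Real.cos (k * |p|) = Real.cos (k * p) := by
    rcases abs_choice p with h | h <;>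
      simp [h, Real.cot_eq_cos_div_sin, div_neg]
  rw [h.1, h.2]

lemma mellinSymbol_abs (s p q : ℝ) : mellinSymbol s |p| |q| = mellinSymbol s p q := by
  simp only [mellinSymbol, pathSymbol_abs]

lemma h1_abs (s p q : ℝ) : h1 s |p| |q| = h1 s p q := by
  simp only [h1, abs_abs, sq_abs]

lemma h2_abs (s p q : ℝ) : h2 s |p| |q| = h2 s p q := by
  simp only [h2, sq_abs]

lemma mellinSymbol_swap_of_abs_ne {s p q : ℝ} (hs : 2 < s) (h : |p| ≠ |q|) :
    mellinSymbol s p q = mellinSymbol s q p := by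
  rw [mellinSymbol_of_abs_ne hs h, mellinSymbol_of_abs_ne hs h.symm,
    ← neg_sub (Real.cos q) (Real.cos p), div_neg]
  ring

lemma h1_swap_of_abs_ne {s p q : ℝ} (h : |p| ≠ |q|) : h1 s p q = h1 s q p := by
  rw [h1, h1, if_pos h, if_pos h.symm, ← neg_sub (|q| ^ s), ← neg_sub (q ^ 2), neg_div_neg_eq]

lemma h2_swap (s p q : ℝ) : h2 s p q = h2 s q p := by
  rw [h2, h2, add_comm]

/-! ### Bounds for `h1` -/

lemma rpow_sub_rpow_div_bounds {s x y : ℝ} (hs : 2 ≤ s) (hy : 0 ≤ y) (hyx : y < x) :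
    x ^ (s - 2) ≤ (x ^ s - y ^ s) / (x ^ 2 - y ^ 2) ∧
      (x ^ s - y ^ s) / (x ^ 2 - y ^ 2) ≤ s / 2 * x ^ (s - 2) := by
  have hx : 0 < x := hy.trans_lt hyx
  have hd : 0 < x ^ 2 - y ^ 2 := by nlinarith
  have hxs : x ^ s = x ^ (s - 2) * x ^ 2 := by
    rw [← Real.rpow_add_natCast hx.ne']; congr 1; push_cast; ring
  rw [le_div_iff₀ hd, div_le_iff₀ hd]
  constructor
  · have : y ^ s ≤ x ^ (s - 2) * y ^ 2 := by
      rcases hy.eq_or_lt with rfl | hy0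
      · rw [Real.zero_rpow (by linarith)]; positivity
      · rw [show y ^ s = y ^ (s - 2) * y ^ 2 by
          rw [← Real.rpow_add_natCast hy0.ne']; congr 1; push_cast; ring]
        have : y ^ (s - 2) ≤ x ^ (s - 2) := Real.rpow_le_rpow hy hyx.le (by linarith)
        gcongr
    rw [hxs]
    linarith
  · -- Bernoulli's inequality for `(y / x) ^ 2` and the exponent `s / 2`
    have hB := one_add_mul_self_le_rpow_one_add (s := (y / x) ^ 2 - 1)
      (by linarith [sq_nonneg (y / x)]) (p := s / 2) (by linarith)
    have hyx' : 0 ≤ y / x := div_nonneg hy hx.le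
    have hpow : ((y / x) ^ 2) ^ (s / 2) = y ^ s / x ^ s := by
      rw [← Real.rpow_natCast (y / x) 2, ← Real.rpow_mul hyx', ← Real.div_rpow hy hx.le]
      congr 1
      push_cast
      ring
    rw [add_sub_cancel, hpow, le_div_iff₀ (by positivity)] at hB
    rw [hxs] at hB ⊢
    have e : (1 + s / 2 * ((y / x) ^ 2 - 1)) * (x ^ (s - 2) * x ^ 2)
        = x ^ (s - 2) * (x ^ 2 + s / 2 * (y ^ 2 - x ^ 2)) := by
      field_simp
    rw [e] at hB
    linarith

/-- `h1` equals `C_s max(|p|, |q|) ^ (s - 2)` up to a factor between `1` and `s / 2`. -/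
lemma exists_h1_eq {s : ℝ} (hs : 2 ≤ s) (p q : ℝ) : ∃ t, 1 ≤ t ∧ t ≤ s / 2 ∧
    h1 s p q = constC s * (t * (max |p| |q|) ^ (s - 2)) := by
  have key : ∀ x y : ℝ, |y| < |x| → ∃ t, 1 ≤ t ∧ t ≤ s / 2 ∧
      h1 s x y = constC s * (t * |x| ^ (s - 2)) := by
    intro x y h
    have hx : 0 < |x| := (abs_nonneg y).trans_lt h
    have hp : 0 < |x| ^ (s - 2) := by positivity
    have hb := rpow_sub_rpow_div_bounds hs (abs_nonneg y) h
    rw [sq_abs, sq_abs] at hb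
    refine ⟨(|x| ^ s - |y| ^ s) / (x ^ 2 - y ^ 2) / |x| ^ (s - 2), ?_, ?_, ?_⟩
    · rw [le_div_iff₀ hp, one_mul]; exact hb.1
    · rw [div_le_iff₀ hp]; exact hb.2
    · rw [h1, if_pos h.ne', div_mul_cancel₀ _ hp.ne']
  rcases lt_trichotomy |p| |q| with h | h | h
  · rw [max_eq_right h.le, h1_swap_of_abs_ne h.ne]; exact key q p h
  · refine ⟨s / 2, by linarith, le_rfl, ?_⟩
    rw [h1, if_neg (not_not.2 h), ← h, max_self]
    ring
  · rw [max_eq_left h.le]; exact key p q h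

lemma abs_h1_le {s : ℝ} (hs : 2 ≤ s) (p q : ℝ) :
    |h1 s p q| ≤ |constC s| * (s / 2) * (max |p| |q|) ^ (s - 2) := by
  obtain ⟨t, h1t, ht, h⟩ := exists_h1_eq hs p q
  have hm : 0 ≤ max |p| |q| := le_max_of_le_left (abs_nonneg p)
  rw [h, abs_mul, abs_of_nonneg (by positivity : 0 ≤ t * (max |p| |q|) ^ (s - 2)), mul_assoc]
  gcongr

/-! ### The expansion of the Mellin symbol -/

lemma half_le_sin {c : ℝ} (h0 : 0 < c) (h1 : c ≤ 1) : c / 2 ≤ Real.sin c := by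
  have := Real.sin_gt_sub_cube h0
  nlinarith [mul_pos h0 h0, mul_le_mul h1 h1 h0.le zero_le_one]

lemma abs_div_cos_sub_cos_le {F F' : ℝ → ℝ} (hF : ∀ x, HasDerivAt F (F' x) x) {x y B : ℝ}
    (hy : 0 ≤ y) (hyx : y < x) (hx : x ≤ 1) (hB : ∀ c ∈ Set.Ioo y x, |F' c| ≤ B * Real.sin c) :
    |(F x - F y) / (Real.cos x - Real.cos y)| ≤ B := by
  have hcos : Real.cos x - Real.cos y < 0 :=
    sub_neg.2 (Real.cos_lt_cos_of_nonneg_of_le_pi hy (by linarith [Real.pi_gt_three]) hyx)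
  obtain ⟨c, hc, h⟩ := exists_ratio_hasDerivAt_eq_ratio_slope F F' hyx
    (fun z _ => (hF z).continuousAt.continuousWithinAt) (fun z _ => hF z) Real.cos
    (fun z => -Real.sin z) Real.continuous_cos.continuousOn (fun z _ => Real.hasDerivAt_cos z)
  have hs : 0 < Real.sin c := Real.sin_pos_of_pos_of_lt_pi (by linarith [hc.1])
    (by linarith [hc.2, Real.pi_gt_three])
  have e : (F x - F y) / (Real.cos x - Real.cos y) = -(F' c / Real.sin c) := by
    rw [div_eq_iff hcos.ne]
    field_simp
    linarith
  rw [e, abs_neg, abs_div, abs_of_pos hs, div_le_iff₀ hs]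
  exact hB c hc

lemma abs_two_mul_one_sub_cos_sub_le {u x : ℝ} (hu : 0 ≤ u) (hux : u ≤ x) (hx : x ≤ 1) :
    |2 * (1 - Real.cos u) - u ^ 2| ≤ x ^ 4 := by
  have h := Real.cos_bound (x := u) (by rw [abs_of_nonneg hu]; linarith)
  rw [abs_of_nonneg hu] at h
  have h4 : u ^ 4 ≤ x ^ 4 := by gcongr
  have h0 : 0 ≤ u ^ 4 := by positivity
  rw [abs_le] at h ⊢
  constructor <;> linarith [h.1, h.2]

lemma mellinSymbol_sub_of_lt {s x y : ℝ} (hs : 2 < s) (hy : 0 ≤ y) (hyx : y < x)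
    (hx : x ≤ 1) :
    mellinSymbol s x y - (h1 s x y + h2 s x y)
      = gammaConst s * ((2 * (1 - Real.cos x) - x ^ 2) + (2 * (1 - Real.cos y) - y ^ 2))
        - h1 s x y * (((x ^ 2 / 2 + Real.cos x) - (y ^ 2 / 2 + Real.cos y))
          / (Real.cos x - Real.cos y))
        + 2 * ((numRemainder s x - numRemainder s y) / (Real.cos x - Real.cos y)) := by
  have hx0 : 0 ≤ x := hy.trans hyx.le
  have hne : |x| ≠ |y| := by rw [abs_of_nonneg hx0, abs_of_nonneg hy]; exact hyx.ne'
  have hcos : Real.cos x - Real.cos y ≠ 0 :=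
    (sub_neg.2 (Real.cos_lt_cos_of_nonneg_of_le_pi hy (by linarith [Real.pi_gt_three]) hyx)).ne
  have ht : x ^ 2 - y ^ 2 ≠ 0 := by
    have : 0 < x ^ 2 - y ^ 2 := by nlinarith
    exact this.ne'
  rw [mellinSymbol_of_abs_ne hs hne, h1, if_pos hne, h2, numRemainder, numRemainder,
    abs_of_nonneg hx0, abs_of_nonneg hy]
  field_simp
  ring

lemma mellinSymbol_sub_of_eq {s x : ℝ} (hs : 2 < s) (hx0 : 0 < x) (hx : x ≤ 1) :
    mellinSymbol s x x - (h1 s x x + h2 s x x)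
      = gammaConst s * ((2 * (1 - Real.cos x) - x ^ 2) + (2 * (1 - Real.cos x) - x ^ 2))
        + h1 s x x * ((x - Real.sin x) / Real.sin x)
        - 2 * (numRemainderDeriv s x / Real.sin x) := by
  have hsin : Real.sin x ≠ 0 := by
    have := half_le_sin hx0 hx
    exact (by linarith : 0 < Real.sin x).ne'
  have hpow : x ^ (s - 1) = x ^ (s - 2) * x := by
    rw [← Real.rpow_add_one hx0.ne']; congr 1; ring
  rw [mellinSymbol_of_abs_eq hs rfl hx0.ne' (by rw [abs_of_pos hx0]; linarith [Real.pi_gt_three]),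
    h1, if_neg (by simp), h2, numRemainderDeriv, abs_of_pos hx0, Real.cot_eq_cos_div_sin, hpow]
  field_simp
  ring

/-- The remainder of the expansion is `O(max(|p|, |q|) ^ α)`. -/
theorem exists_abs_mellinSymbol_sub_le {s α : ℝ} (hs : 2 < s) (hs4 : s ≠ 4) (hα0 : 0 ≤ α)
    (hα : α ≤ 4) (hα6 : s = 6 → α < 4) (hαs : α ≤ s) :
    ∃ K δ : ℝ, 0 < δ ∧ ∀ p q : ℝ, max |p| |q| < δ →
      |mellinSymbol s p q - (h1 s p q + h2 s p q)| ≤ K * (max |p| |q|) ^ α := by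
  obtain ⟨K, hK, hb⟩ := (numRemainderDeriv_isBigO hs hs4 hα0 hα hα6 hαs).exists_nonneg
  obtain ⟨δ, hδ, hb⟩ := mem_nhdsGT_iff_exists_Ioo_subset.1 hb.bound
  have hδ0 : 0 < δ := hδ
  have hR : ∀ c x, 0 < c → c ≤ x → x < δ → x ≤ 1 →
      |numRemainderDeriv s c| ≤ 2 * K * x ^ α * Real.sin c := by
    intro c x hc hcx hxδ hx1
    have h := hb ⟨hc, hcx.trans_lt hxδ⟩
    simp only [Set.mem_ofPred_eq, Real.norm_eq_abs] at h
    rw [abs_of_nonneg (by positivity : 0 ≤ c ^ (α + 1)), Real.rpow_add_one hc.ne'] at h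
    have hs := half_le_sin hc (hcx.trans hx1)
    have hx0 : 0 < x := hc.trans_le hcx
    calc _ ≤ K * (c ^ α * c) := h
      _ ≤ K * (x ^ α * (2 * Real.sin c)) := by gcongr; linarith
      _ = _ := by ring
  have hcub : ∀ c x, 0 < c → c ≤ x → x ≤ 1 → |c - Real.sin c| ≤ x ^ 2 / 2 * Real.sin c := by
    intro c x hc hcx hx1
    have h := Real.sin_gt_sub_cube hc
    have hs := half_le_sin hc (hcx.trans hx1)
    rw [abs_of_nonneg (by linarith [Real.sin_lt hc])]
    have h3 : 0 < c ^ 3 := by positivity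
    calc c - Real.sin c ≤ c ^ 2 / 2 * (c / 2) := by linarith
      _ ≤ _ := by gcongr
  have htot : ∀ x A H R : ℝ, 0 < x → x ≤ 1 → |A| ≤ x ^ 4 + x ^ 4 →
      |H| ≤ |constC s| * (s / 2) * x ^ (s - 2) * (x ^ 2 / 2) → |R| ≤ 2 * K * x ^ α →
      |gammaConst s * A| + |H| + |2 * R| ≤ (2 * |gammaConst s| + |constC s| * s + 4 * K) * x ^ α := by
    intro x A H R hx0 hx1 hA hH hR
    have h4 : x ^ 4 ≤ x ^ α := by
      rw [← Real.rpow_natCast]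
      exact Real.rpow_le_rpow_of_exponent_ge hx0 hx1 (by exact_mod_cast hα)
    have hs' : x ^ (s - 2) * x ^ 2 ≤ x ^ α := by
      rw [← Real.rpow_add_natCast hx0.ne']
      exact Real.rpow_le_rpow_of_exponent_ge hx0 hx1 (by push_cast; linarith)
    have h1 : |gammaConst s * A| ≤ |gammaConst s| * (x ^ α + x ^ α) := by
      rw [abs_mul]; gcongr; linarith
    have h2 : |H| ≤ |constC s| * s * x ^ α := by
      calc |H| ≤ |constC s| * s / 4 * (x ^ (s - 2) * x ^ 2) := by linarith
        _ ≤ |constC s| * s / 4 * x ^ α := by gcongr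
        _ ≤ _ := by
          have : 0 ≤ |constC s| * s * x ^ α := by positivity
          linarith
    rw [abs_mul 2, abs_two]
    linarith
  have hlt : ∀ x y : ℝ, 0 ≤ y → y < x → x < δ → x ≤ 1 →
      |mellinSymbol s x y - (h1 s x y + h2 s x y)|
        ≤ (2 * |gammaConst s| + |constC s| * s + 4 * K) * x ^ α := by
    intro x y hy hyx hxδ hx1
    have hx0 : 0 < x := hy.trans_lt hyx
    rw [mellinSymbol_sub_of_lt hs hy hyx hx1]
    refine (abs_add_le _ _).trans ((add_le_add_left (abs_sub _ _) _).trans ?_)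
    refine htot x _ _ _ hx0 hx1 ?_ ?_ ?_
    · exact (abs_add_le _ _).trans (add_le_add
        (abs_two_mul_one_sub_cos_sub_le hx0.le le_rfl hx1)
        (abs_two_mul_one_sub_cos_sub_le hy hyx.le hx1))
    · have hh := abs_h1_le hs.le x y
      rw [abs_of_pos hx0, abs_of_nonneg hy, max_eq_left hyx.le] at hh
      rw [abs_mul]
      refine mul_le_mul hh ?_ (abs_nonneg _) (by positivity)
      refine abs_div_cos_sub_cos_le (F := fun z => z ^ 2 / 2 + Real.cos z)
        (F' := fun z => z - Real.sin z) (fun z => ?_) hy hyx hx1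
        fun c hc => hcub c x (hy.trans_lt hc.1) hc.2.le hx1
      refine (((hasDerivAt_pow 2 z).div_const 2).add (Real.hasDerivAt_cos z)).congr_deriv ?_
      push_cast
      ring
    · exact abs_div_cos_sub_cos_le (hasDerivAt_numRemainder hs) hy hyx hx1
        fun c hc => hR c x (hy.trans_lt hc.1) hc.2.le hxδ hx1
  refine ⟨2 * |gammaConst s| + |constC s| * s + 4 * K, min δ 1,
    lt_min hδ0 one_pos, fun p q hpq => ?_⟩
  have hmax : 0 ≤ max |p| |q| := le_max_of_le_left (abs_nonneg p)
  have hδm := hpq.trans_le (min_le_left _ _)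
  have h1m := (hpq.trans_le (min_le_right _ _)).le
  rcases lt_trichotomy |p| |q| with h | h | h
  · rw [mellinSymbol_swap_of_abs_ne hs h.ne, h1_swap_of_abs_ne h.ne, h2_swap, ← mellinSymbol_abs,
      ← h1_abs, ← h2_abs]
    rw [max_eq_right h.le] at hδm h1m ⊢
    exact hlt _ _ (abs_nonneg p) h hδm h1m
  · rw [← mellinSymbol_abs, ← h1_abs, ← h2_abs, ← h]
    rw [← h, max_self] at hδm h1m
    rw [max_self]
    rcases (abs_nonneg p).eq_or_lt with h0 | h0
    · rw [← h0, mellinSymbol_zero, h1, if_neg (by simp), h2, abs_zero,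
        Real.zero_rpow (by linarith)]
      simp only [mul_zero, ne_eq, OfNat.ofNat_ne_zero, not_false_eq_true, zero_pow, add_zero,
        sub_zero, abs_zero]
      positivity
    · have hsin : 0 < Real.sin |p| := by linarith [half_le_sin h0 h1m]
      rw [mellinSymbol_sub_of_eq hs h0 h1m]
      refine (abs_sub _ _).trans ((add_le_add_left (abs_add_le _ _) _).trans ?_)
      refine htot |p| _ _ _ h0 h1m ?_ ?_ ?_
      · have := abs_two_mul_one_sub_cos_sub_le h0.le le_rfl h1m
        exact (abs_add_le _ _).trans (add_le_add this this)
      · have hh := abs_h1_le hs.le |p| |p|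
        rw [max_self, abs_abs] at hh
        rw [abs_mul]
        refine mul_le_mul hh ?_ (abs_nonneg _) (by positivity)
        rw [abs_div, abs_of_pos hsin, div_le_iff₀ hsin]
        exact hcub _ _ h0 le_rfl h1m
      · rw [abs_div, abs_of_pos hsin, div_le_iff₀ hsin]
        exact hR _ _ h0 le_rfl hδm h1m
  · rw [← mellinSymbol_abs, ← h1_abs, ← h2_abs]
    rw [max_eq_left h.le] at hδm h1m ⊢
    exact hlt _ _ (abs_nonneg q) h hδm h1m

/-! ### Asymptotics at the origin -/

/-- `max(|p|, |q|)`, the gauge in which all error terms are measured. -/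
def maxAbs (x : ℝ × ℝ) : ℝ := max |x.1| |x.2|

lemma maxAbs_nonneg (x : ℝ × ℝ) : 0 ≤ maxAbs x := le_max_of_le_left (abs_nonneg x.1)

lemma tendsto_maxAbs : Tendsto maxAbs (𝓝 (0, 0)) (𝓝 0) := by
  have : Continuous maxAbs := continuous_fst.abs.max continuous_snd.abs
  simpa [maxAbs] using this.tendsto (0, 0)

lemma eventually_maxAbs_lt {δ : ℝ} (hδ : 0 < δ) : ∀ᶠ x in 𝓝 ((0, 0) : ℝ × ℝ), maxAbs x < δ :=
  tendsto_maxAbs.eventually_lt_const hδ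

lemma maxAbs_rpow_le_add (x : ℝ × ℝ) (r : ℝ) : maxAbs x ^ r ≤ |x.1| ^ r + |x.2| ^ r := by
  have h1 : 0 ≤ |x.1| ^ r := Real.rpow_nonneg (abs_nonneg _) _
  have h2 : 0 ≤ |x.2| ^ r := Real.rpow_nonneg (abs_nonneg _) _
  rcases max_choice |x.1| |x.2| with h | h <;> rw [maxAbs, h] <;> linarith

lemma maxAbs_rpow_isBigO_add (r : ℝ) :
    (fun x => maxAbs x ^ r) =O[𝓝 (0, 0)] fun x : ℝ × ℝ => |x.1| ^ r + |x.2| ^ r := by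
  refine IsBigO.of_bound 1 (Eventually.of_forall fun x => ?_)
  rw [one_mul, Real.norm_of_nonneg (Real.rpow_nonneg (maxAbs_nonneg x) r)]
  exact (maxAbs_rpow_le_add x r).trans (le_abs_self _)

lemma maxAbs_rpow_isBigO {a b : ℝ} (ha : 0 < a) (h : b ≤ a) :
    (fun x => maxAbs x ^ a) =O[𝓝 (0, 0)] fun x => maxAbs x ^ b := by
  refine IsBigO.of_bound 1 ?_
  filter_upwards [eventually_maxAbs_lt one_pos] with x hx
  have h0 := maxAbs_nonneg x
  rw [one_mul, Real.norm_of_nonneg (by positivity), Real.norm_of_nonneg (by positivity)]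
  rcases h0.eq_or_lt with h0 | h0
  · rw [← h0, Real.zero_rpow ha.ne']
    exact Real.rpow_nonneg le_rfl b
  · exact Real.rpow_le_rpow_of_exponent_ge h0 hx.le h

lemma maxAbs_rpow_isLittleO {a b : ℝ} (hb : 0 < b) (h : b < a) :
    (fun x => maxAbs x ^ a) =o[𝓝 (0, 0)] fun x => maxAbs x ^ b := by
  have ht : Tendsto (fun x => maxAbs x ^ (a - b)) (𝓝 (0, 0)) (𝓝 0) := by
    have := tendsto_maxAbs.rpow_const (p := a - b) (Or.inr (by linarith))
    rwa [Real.zero_rpow (by linarith)] at this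
  refine (((isLittleO_one_iff ℝ).2 ht).mul_isBigO (isBigO_refl (fun x => maxAbs x ^ b) _)).congr
    (fun x => ?_) fun x => one_mul _
  rw [← Real.rpow_add_of_nonneg (maxAbs_nonneg x) (by linarith) hb.le, sub_add_cancel]

lemma maxAbs_rpow_two_isBigO_sq :
    (fun x => maxAbs x ^ (2 : ℝ)) =O[𝓝 (0, 0)] fun x : ℝ × ℝ => x.1 ^ 2 + x.2 ^ 2 := by
  refine (maxAbs_rpow_isBigO_add 2).congr_right fun x => ?_
  simp only [Real.rpow_two, sq_abs]

lemma sq_isBigO_maxAbs_rpow_two :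
    (fun x : ℝ × ℝ => x.1 ^ 2 + x.2 ^ 2) =O[𝓝 (0, 0)] fun x => maxAbs x ^ (2 : ℝ) := by
  refine IsBigO.of_bound 2 (Eventually.of_forall fun x => ?_)
  have h1 : x.1 ^ 2 ≤ maxAbs x ^ 2 := by
    rw [← sq_abs]; gcongr; exact le_max_left _ _
  have h2 : x.2 ^ 2 ≤ maxAbs x ^ 2 := by
    rw [← sq_abs]; gcongr; exact le_max_right _ _
  rw [Real.rpow_two, Real.norm_of_nonneg (by positivity), Real.norm_of_nonneg (by positivity)]
  linarith

lemma h1_isBigO {s : ℝ} (hs : 2 ≤ s) :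
    (fun x : ℝ × ℝ => h1 s x.1 x.2) =O[𝓝 (0, 0)] fun x => maxAbs x ^ (s - 2) := by
  refine IsBigO.of_bound (|constC s| * (s / 2)) (Eventually.of_forall fun x => ?_)
  rw [Real.norm_of_nonneg (Real.rpow_nonneg (maxAbs_nonneg x) _)]
  exact abs_h1_le hs x.1 x.2

lemma maxAbs_rpow_isBigO_h1 {s : ℝ} (hs : 2 ≤ s) (hC : 0 < constC s) :
    (fun x => maxAbs x ^ (s - 2)) =O[𝓝 (0, 0)] fun x : ℝ × ℝ => h1 s x.1 x.2 := by
  refine IsBigO.of_bound (1 / constC s) (Eventually.of_forall fun x => ?_)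
  obtain ⟨t, ht, -, h⟩ := exists_h1_eq hs x.1 x.2
  have hm := Real.rpow_nonneg (maxAbs_nonneg x) (s - 2)
  have e : 1 / constC s * h1 s x.1 x.2 = t * maxAbs x ^ (s - 2) := by
    rw [h, maxAbs]; field_simp
  rw [Real.norm_of_nonneg hm, ← Real.norm_of_nonneg (by positivity : 0 ≤ 1 / constC s), ← norm_mul, e]
  exact (le_mul_of_one_le_left hm ht).trans (le_abs_self _)

lemma h2_isBigO (s : ℝ) :
    (fun x : ℝ × ℝ => h2 s x.1 x.2) =O[𝓝 (0, 0)] fun x : ℝ × ℝ => x.1 ^ 2 + x.2 ^ 2 :=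
  (isBigO_refl _ _).const_mul_left _

lemma mellinSymbol_sub_isBigO {s α : ℝ} (hs : 2 < s) (hs4 : s ≠ 4) (hα0 : 0 ≤ α)
    (hα : α ≤ 4) (hα6 : s = 6 → α < 4) (hαs : α ≤ s) :
    (fun x : ℝ × ℝ => mellinSymbol s x.1 x.2 - (h1 s x.1 x.2 + h2 s x.1 x.2))
      =O[𝓝 (0, 0)] fun x => maxAbs x ^ α := by
  obtain ⟨K, δ, hδ, h⟩ := exists_abs_mellinSymbol_sub_le hs hs4 hα0 hα hα6 hαs
  refine IsBigO.of_bound K ?_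
  filter_upwards [eventually_maxAbs_lt hδ] with x hx
  rw [Real.norm_of_nonneg (Real.rpow_nonneg (maxAbs_nonneg x) _)]
  exact h x.1 x.2 hx

lemma mellinSymbol_six_sub_isBigO {ε : ℝ} (hε : 0 < ε) :
    (fun x : ℝ × ℝ => mellinSymbol 6 x.1 x.2 - (h1 6 x.1 x.2 + h2 6 x.1 x.2))
      =O[𝓝 (0, 0)] fun x => maxAbs x ^ (4 - ε) := by
  -- for `ε ≥ 4` the exponent `3` is more than enough
  refine (mellinSymbol_sub_isBigO (α := max (4 - ε) 3) (by norm_num) (by norm_num)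
    (le_max_of_le_right (by norm_num)) (max_le (by linarith) (by norm_num))
    (fun _ => max_lt (by linarith) (by norm_num)) (max_le (by linarith) (by norm_num))).trans
    (maxAbs_rpow_isBigO (lt_max_of_lt_right (by norm_num)) (le_max_left _ _))

lemma h1_six (p q : ℝ) : h1 6 p q = 0 := by
  simp [h1, constC_six]

lemma gammaConst_pos {s : ℝ} (hs : 4 < s) : 0 < gammaConst s := by
  have h1 := riemannZeta_re_pos (r := s - 1) (by linarith)
  have h3 := riemannZeta_re_pos (r := s - 3) (by linarith)
  rw [gammaConst]
  positivity

lemma mellinSymbol_sub_h2_isBigO {s : ℝ} (hs : 4 < s) (hs6 : s ≠ 6) :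
    (fun x : ℝ × ℝ => mellinSymbol s x.1 x.2 - h2 s x.1 x.2)
      =O[𝓝 (0, 0)] fun x => maxAbs x ^ min (s - 2) 4 := by
  have h := (mellinSymbol_sub_isBigO (α := 4) (by linarith) hs.ne' (by norm_num) le_rfl
    (fun h => absurd h hs6) hs.le).trans (maxAbs_rpow_isBigO (by norm_num) (min_le_right (s - 2) 4))
  have h' := (h1_isBigO (s := s) (by linarith)).trans
    (maxAbs_rpow_isBigO (by linarith) (min_le_left (s - 2) 4))
  exact (h.add h').congr_left fun x => by ring

lemma mellinSymbol_six_sub_h2_isBigO {ε : ℝ} (hε : 0 < ε) :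
    (fun x : ℝ × ℝ => mellinSymbol 6 x.1 x.2 - h2 6 x.1 x.2)
      =O[𝓝 (0, 0)] fun x => maxAbs x ^ (4 - ε) := by
  simpa only [h1_six, zero_add] using mellinSymbol_six_sub_isBigO hε

lemma mellinSymbol_sub_h1_isBigO {s : ℝ} (hs : 2 < s) (hs4 : s < 4) :
    (fun x : ℝ × ℝ => mellinSymbol s x.1 x.2 - h1 s x.1 x.2)
      =O[𝓝 (0, 0)] fun x : ℝ × ℝ => x.1 ^ 2 + x.2 ^ 2 := by
  have h := ((mellinSymbol_sub_isBigO (α := s) hs hs4.ne (by linarith) hs4.le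
    (fun h => absurd h (by linarith)) le_rfl).trans
    (maxAbs_rpow_isBigO (by linarith) hs.le)).trans maxAbs_rpow_two_isBigO_sq
  exact (h.add (h2_isBigO s)).congr_left fun x => by ring

lemma mellinSymbol_isEquivalent_h1 {s : ℝ} (hs : 2 < s) (hs4 : s < 4) :
    (fun x : ℝ × ℝ => mellinSymbol s x.1 x.2) ~[𝓝 (0, 0)] fun x : ℝ × ℝ => h1 s x.1 x.2 :=
  (((mellinSymbol_sub_h1_isBigO hs hs4).trans sq_isBigO_maxAbs_rpow_two).trans_isLittleO
    (maxAbs_rpow_isLittleO (b := s - 2) (by linarith) (by linarith))).trans_isBigO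
    (maxAbs_rpow_isBigO_h1 hs.le (constC_pos hs hs4))

lemma mellinSymbol_isEquivalent_h2 {s : ℝ} (hs : 4 < s) :
    (fun x : ℝ × ℝ => mellinSymbol s x.1 x.2) ~[𝓝 (0, 0)] fun x : ℝ × ℝ => h2 s x.1 x.2 := by
  obtain ⟨r, hr, h⟩ : ∃ r : ℝ, 2 < r ∧
      (fun x : ℝ × ℝ => mellinSymbol s x.1 x.2 - h2 s x.1 x.2)
        =O[𝓝 (0, 0)] fun x => maxAbs x ^ r := by
    rcases eq_or_ne s 6 with rfl | hs6
    · exact ⟨4 - 1, by norm_num, mellinSymbol_six_sub_h2_isBigO one_pos⟩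
    · exact ⟨min (s - 2) 4, lt_min (by linarith) (by norm_num), mellinSymbol_sub_h2_isBigO hs hs6⟩
  refine ((h.trans_isLittleO (maxAbs_rpow_isLittleO two_pos hr)).trans_isBigO
    maxAbs_rpow_two_isBigO_sq).trans_isBigO ?_
  exact (isBigO_refl _ _).const_mul_right (gammaConst_pos hs).ne'

end PathLaplacian

end

theorem proposition4p5 (s : ℝ) (hs : 2 < s) (hs4 : s ≠ 4) :
    -- `l_s = h_{1,s} + h_{2,s} + O(|p|^α + |q|^α)` with `α = min {s, 4}` if `s ≠ 6`
    (s ≠ 6 →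
      (fun x : ℝ × ℝ => PathLaplacian.mellinSymbol s x.1 x.2
          - (PathLaplacian.h1 s x.1 x.2 + PathLaplacian.h2 s x.1 x.2))
        =O[𝓝 (0, 0)] fun x : ℝ × ℝ => |x.1| ^ (min s 4) + |x.2| ^ (min s 4)) ∧
    -- and with `α = 4 - ε`, for every `ε > 0`, if `s = 6`
    (s = 6 → ∀ ε : ℝ, 0 < ε →
      (fun x : ℝ × ℝ => PathLaplacian.mellinSymbol s x.1 x.2
          - (PathLaplacian.h1 s x.1 x.2 + PathLaplacian.h2 s x.1 x.2))
        =O[𝓝 (0, 0)] fun x : ℝ × ℝ => |x.1| ^ (4 - ε) + |x.2| ^ (4 - ε)) ∧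
    -- `h_{1,s}` dominates for `s ∈ (2, 4)`
    (s < 4 →
      (fun x : ℝ × ℝ => PathLaplacian.mellinSymbol s x.1 x.2 - PathLaplacian.h1 s x.1 x.2)
          =O[𝓝 (0, 0)] (fun x : ℝ × ℝ => x.1 ^ 2 + x.2 ^ 2) ∧
        (fun x : ℝ × ℝ => PathLaplacian.mellinSymbol s x.1 x.2)
          ~[𝓝 (0, 0)] fun x : ℝ × ℝ => PathLaplacian.h1 s x.1 x.2) ∧
    -- `h_{2,s}` dominates for `s > 4`
    (4 < s → s ≠ 6 →
      (fun x : ℝ × ℝ => PathLaplacian.mellinSymbol s x.1 x.2 - PathLaplacian.h2 s x.1 x.2)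
        =O[𝓝 (0, 0)] fun x : ℝ × ℝ => |x.1| ^ (min (s - 2) 4) + |x.2| ^ (min (s - 2) 4)) ∧
    (s = 6 → ∀ ε : ℝ, 0 < ε →
      (fun x : ℝ × ℝ => PathLaplacian.mellinSymbol s x.1 x.2 - PathLaplacian.h2 s x.1 x.2)
        =O[𝓝 (0, 0)] fun x : ℝ × ℝ => |x.1| ^ (4 - ε) + |x.2| ^ (4 - ε)) ∧
    (4 < s →
      (fun x : ℝ × ℝ => PathLaplacian.mellinSymbol s x.1 x.2)
        ~[𝓝 (0, 0)] fun x : ℝ × ℝ => PathLaplacian.h2 s x.1 x.2) := by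
  open PathLaplacian in
  refine ⟨fun h6 => ?_, ?_, fun h4 => ⟨mellinSymbol_sub_h1_isBigO hs h4,
    mellinSymbol_isEquivalent_h1 hs h4⟩, fun h4 h6 => ?_, ?_, mellinSymbol_isEquivalent_h2⟩
  · exact (mellinSymbol_sub_isBigO hs hs4 (le_min (by linarith) (by norm_num)) (min_le_right _ _)
      (fun h => absurd h h6) (min_le_left _ _)).trans (maxAbs_rpow_isBigO_add _)
  · rintro rfl ε hε
    exact (mellinSymbol_six_sub_isBigO hε).trans (maxAbs_rpow_isBigO_add _)
  · exact (mellinSymbol_sub_h2_isBigO h4 h6).trans (maxAbs_rpow_isBigO_add _)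
  · rintro rfl ε hε
    exact (mellinSymbol_six_sub_h2_isBigO hε).trans (maxAbs_rpow_isBigO_add _)
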